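/- For $r\in(0,1)$, a packing by discs of radii $1$ and $r$ is a set of closed discs in the Euclidean plane, each of radius $1$ or $r$, with pairwise disjoint interiors. Its density is $$\limsup_{k\to\infty}\frac{\text{area of the part of }[-k,k]^2\text{ covered by the discs}}{\text{area of }[-k,k]^2}.$$ Let $\delta(r)$ be the supremum of the densities of all packings by discs of radii $1$ and $r$, and let $\delta_1=\frac{\pi}{2\sqrt3}$ be the density of the hexagonal compact packing of equal discs. Put $$\begin{aligned} P_{14}(x)={}&3x^{12}+24x^{11}+90x^{10}+216x^9+381x^8+528x^7+524x^6+144x^5-387x^4-296x^3+90x^2+24x+3\\ ={}&3(x^2+1)^2(x+1)^8-64x^3(x+2)^3,\\ P_2(x)={}&144x^{12}+576x^{11}+1152x^{10}+1728x^9+1704x^8+672x^7+312x^6-384x^5-143x^4+52x^3-50x^2-12x+9,\\ P_3(x)={}&14641x^{12}+20812x^{11}-19950x^{10}+2204x^9-72961x^8-179688x^7-42116x^6-179688x^5\\ &-72961x^4+2204x^3-19950x^2+20812x+14641,\\ P_5(x)={}&9x^{15}+81x^{14}+369x^{13}+1161x^{12}+2757x^{11}+4749x^{10}+5805x^9+5445x^8+3643x^7+1235x^6\\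 &+243x^5-1029x^4-969x^3-369x^2-81x-9. \end{aligned}$$ Then, within distance $0.0002$ of $0.4378$, $0.5165$, $0.5510$, $0.6276$ and $0.6456$, respectively, the polynomials $P_{14}$, $P_2$, $P_3$, $P_{14}$ and $P_5$ have exactly one real root each; call these algebraic numbers $a_1$, $a_2$, $a_3$, $a_4$ and $a_5$ (more precisely, $a_1=0.43784\ldots$, $a_2=0.51643\ldots$, $a_3=0.55100\ldots$, $a_4=0.62746\ldots$, $a_5=0.64570\ldots$). For every $r\in(0,a_1)\cup(a_2,a_3)\cup(a_4,a_5)$ one has $$\delta(r)>\delta_1 .$$ -/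

import Mathlib

open MeasureTheory Filter Polynomial

noncomputable section

namespace BinaryDisc

/-- The Euclidean plane. -/
abbrev Plane : Type := EuclideanSpace ℝ (Fin 2)

/-- A packing by discs of radii `1` and `r`. A disc is given by its centre and its radius, every
radius is `1` or `r`, and the interiors of different discs are disjoint. -/
structure IsPacking (r : ℝ) (S : Set (Plane × ℝ)) : Prop where
  radius : ∀ d ∈ S, d.2 = 1 ∨ d.2 = r
  interior_disjoint : S.PairwiseDisjoint fun d => Metric.ball d.1 d.2

/-- The part of the plane covered by the (closed) discs of `S`. -/
def covered (S : Set (Plane × ℝ)) : Set Plane :=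
  ⋃ d ∈ S, Metric.closedBall d.1 d.2

/-- The square `[-k, k]²`. -/
def square (k : ℝ) : Set Plane :=
  {x | ∀ i, x i ∈ Set.Icc (-k) k}

/-- The density of a set of discs: the upper limit, as `k → ∞`, of the proportion of the
square `[-k, k]²` that is covered by the discs. -/
def density (S : Set (Plane × ℝ)) : ℝ :=
  limsup (fun k : ℝ => volume.real (covered S ∩ square k) / volume.real (square k)) atTop

/-- The maximal density `δ(r)` of packings by discs of radii `1` and `r`. -/
def maxDensity (r : ℝ) : ℝ :=
  sSup {t : ℝ | ∃ S : Set (Plane × ℝ), IsPacking r S ∧ density S = t}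

/-- The density `δ₁ = π / (2 √3)` of the hexagonal compact packing of equal discs. -/
def hexDensity : ℝ := Real.pi / (2 * Real.sqrt 3)

/-- The minimal polynomial of `a₁` and of `a₄` (up to its leading coefficient). It is the expansion of
`3 (x² + 1)² (x + 1)⁸ - 64 x³ (x + 2)³`. -/
def poly₁₄ : ℤ[X] :=
  3 * X ^ 12 + 24 * X ^ 11 + 90 * X ^ 10 + 216 * X ^ 9 + 381 * X ^ 8 + 528 * X ^ 7
    + 524 * X ^ 6 + 144 * X ^ 5 - 387 * X ^ 4 - 296 * X ^ 3 + 90 * X ^ 2 + 24 * X + 3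

/-- The minimal polynomial of `a₂` (up to its leading coefficient). -/
def poly₂ : ℤ[X] :=
  144 * X ^ 12 + 576 * X ^ 11 + 1152 * X ^ 10 + 1728 * X ^ 9 + 1704 * X ^ 8 + 672 * X ^ 7
    + 312 * X ^ 6 - 384 * X ^ 5 - 143 * X ^ 4 + 52 * X ^ 3 - 50 * X ^ 2 - 12 * X + 9

/-- The minimal polynomial of `a₃` (up to its leading coefficient). -/
def poly₃ : ℤ[X] :=
  14641 * X ^ 12 + 20812 * X ^ 11 - 19950 * X ^ 10 + 2204 * X ^ 9 - 72961 * X ^ 8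
    - 179688 * X ^ 7 - 42116 * X ^ 6 - 179688 * X ^ 5 - 72961 * X ^ 4 + 2204 * X ^ 3
    - 19950 * X ^ 2 + 20812 * X + 14641

/-- The minimal polynomial of `a₅` (up to its leading coefficient). -/
def poly₅ : ℤ[X] :=
  9 * X ^ 15 + 81 * X ^ 14 + 369 * X ^ 13 + 1161 * X ^ 12 + 2757 * X ^ 11 + 4749 * X ^ 10
    + 5805 * X ^ 9 + 5445 * X ^ 8 + 3643 * X ^ 7 + 1235 * X ^ 6 + 243 * X ^ 5 - 1029 * X ^ 4
    - 969 * X ^ 3 - 369 * X ^ 2 - 81 * X - 9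

/-- `a` is the only real root of `P` whose distance to `c` is less than `0.0002`. -/
def IsOnlyRootNear (P : ℤ[X]) (c a : ℝ) : Prop :=
  {x : ℝ | |x - c| < 0.0002 ∧ aeval x P = 0} = {a}

end BinaryDisc

end

/-!
A periodic packing with lattice cell of area `A`, containing `a` large and `b` small discs, has density
`π (a + b r²) / A`, so it beats the hexagonal packing as soon as `A < 2 √3 (a + b r²)`
(`hexDensity_lt_maxDensity_of_periodic`). Hence it is enough to name a periodic packing for each `r`.

For `r ≤ 0.154` a small disc fits into every hole of the hexagonal packing. For most of the other
radii there is room to spare: a packing that is made for the small radius `hi` remains one for all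
smaller radii, and it beats the hexagonal packing for all `r` from some `lo < hi` on. Finitely many
such packings, with integer coordinates in units of `10⁻⁵`, cover everything but short intervals next
to `a₁`, …, `a₅`. The tables `cellsA`, `cellsB` and `cellsC` list them, and all of their distances
are checked by integer arithmetic (`Cell.Valid`, `Cell.Covers.hexDensity_lt`).

Next to `a₁`, …, `a₅` there is one family of packings each, whose discs are in contact as long as `r`
varies, and whose density equals that of the hexagonal packing exactly at the root. The coordinates
are algebraic functions of `r`. The distances of the discs in contact are identities between these,
whereas for all other pairs of discs rough numerical bounds on the coordinates suffice, and are again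
compared with a table of integers (`Cell.Stable.hexDensity_lt_maxDensity`). The density exceeds that
of the hexagonal packing if a certain element of an algebraic extension of `ℚ(r)` is positive; all
of its conjugates but itself have a known sign, and its norm is, up to factors of known sign, the
polynomial that defines the root (`row_area_lt`, `pair_area_lt`, `triangle_pos`; for the trapezoids
near `a₁` and `a₄`, squaring is enough). These polynomials are monotone near their roots
(`exists_isOnlyRootNear`), so their sign there is known.
-/

noncomputable section

namespace BinaryDisc

/-! ### The density of periodic packings -/

lemma volume_real_square {k : ℝ} (hk : 0 ≤ k) : volume.real (square k) = (2 * k) ^ 2 := by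
  have h : square k = (WithLp.ofLp : Plane → Fin 2 → ℝ) ⁻¹'
      Set.Icc (fun _ => -k) (fun _ => k) := by
    ext x
    simp [square, Pi.le_def, forall_and]
  rw [h, Measure.real, (PiLp.volume_preserving_ofLp (Fin 2)).measure_preimage
    measurableSet_Icc.nullMeasurableSet, Real.volume_Icc_pi, Fin.prod_univ_two,
    ← ENNReal.ofReal_mul (by linarith), ENNReal.toReal_ofReal (by nlinarith)]
  ring

lemma isCompact_square (k : ℝ) : IsCompact (square k) := by
  have h : square k = (EuclideanSpace.equiv (Fin 2) ℝ).toHomeomorph ⁻¹'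
      Set.Icc (fun _ => -k) (fun _ => k) := by
    ext x
    simp [square, Pi.le_def, forall_and]
  rw [h, Homeomorph.isCompact_preimage]
  exact isCompact_Icc

lemma convex_square (k : ℝ) : Convex ℝ (square k) := by
  intro x hx y hy a b ha hb hab i
  simpa using (convex_Icc (-k) k) (hx i) (hy i) ha hb hab

lemma density_ratio_mem_Icc (S : Set (Plane × ℝ)) (k : ℝ) :
    volume.real (covered S ∩ square k) / volume.real (square k) ∈ Set.Icc (0 : ℝ) 1 := by
  refine ⟨by positivity, div_le_one_of_le₀ ?_ measureReal_nonneg⟩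
  exact measureReal_mono Set.inter_subset_right (isCompact_square k).measure_ne_top

lemma density_le_one (S : Set (Plane × ℝ)) : density S ≤ 1 := by
  refine limsup_le_of_le ?_ (Eventually.of_forall fun k => (density_ratio_mem_Icc S k).2)
  exact isCoboundedUnder_le_of_le atTop (x := 0) fun k => (density_ratio_mem_Icc S k).1

lemma density_le_maxDensity {r : ℝ} {S : Set (Plane × ℝ)} (h : IsPacking r S) :
    density S ≤ maxDensity r :=
  le_csSup ⟨1, by rintro _ ⟨T, -, rfl⟩; exact density_le_one T⟩ ⟨S, h, rfl⟩

/-- A limit of the covered proportion along a sequence of squares that grow to the whole plane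
bounds the density from below. -/
lemma le_density_of_tendsto {S : Set (Plane × ℝ)} {k : ℕ → ℝ} (hk : Tendsto k atTop atTop)
    {f : ℕ → ℝ} {a : ℝ} (hf : Tendsto f atTop (nhds a))
    (h : ∀ᶠ n in atTop, f n ≤ volume.real (covered S ∩ square (k n)) /
      volume.real (square (k n))) : a ≤ density S := by
  refine le_of_forall_lt fun c hc => ?_
  obtain ⟨d, hcd, hda⟩ := exists_between hc
  refine hcd.trans_le (le_limsup_of_frequently_le ?_ ?_)
  · refine hk.frequently (Eventually.frequently ?_)
    filter_upwards [h, hf.eventually (lt_mem_nhds hda)] with n h1 h2 using h2.le.trans h1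
  · exact isBoundedUnder_of ⟨1, fun k => (density_ratio_mem_Icc S k).2⟩

/-- The discs obtained from finitely many discs, with centres `p i` and radii `ρ i`, by the
translations of the lattice spanned by a basis of the plane. -/
def periodicDiscs {ι : Type*} (b : Module.Basis (Fin 2) ℝ Plane) (p : ι → Plane) (ρ : ι → ℝ) :
    Set (Plane × ℝ) :=
  {d | ∃ i, ∃ l ∈ Submodule.span ℤ (Set.range b), d = (p i + l, ρ i)}

lemma covolume_span (b : Module.Basis (Fin 2) ℝ Plane) :
    ZLattice.covolume (Submodule.span ℤ (Set.range b)) = |b 0 0 * b 1 1 - b 0 1 * b 1 0| := by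
  rw [ZLattice.covolume_eq_measure_fundamentalDomain _ volume
    (ZSpan.isAddFundamentalDomain b volume),
    ZSpan.measureReal_fundamentalDomain b volume (EuclideanSpace.basisFun (Fin 2) ℝ).toBasis,
    measureReal_congr (ZSpan.fundamentalDomain_ae_parallelepiped _ volume),
    measureReal_def]
  have := OrthonormalBasis.volume_parallelepiped (EuclideanSpace.basisFun (Fin 2) ℝ)
  simp only [OrthonormalBasis.coe_toBasis] at this ⊢
  rw [this, Module.Basis.det_apply, Matrix.det_fin_two]
  simp [Module.Basis.toMatrix_apply]
  ring_nf

open Pointwise in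
lemma card_square_inter_smul (L : Submodule ℤ Plane) {n : ℕ} (hn : 0 < n) :
    Nat.card (square 1 ∩ (n : ℝ)⁻¹ • (L : Set Plane) : Set Plane)
      = ((L : Set Plane) ∩ square n).ncard := by
  have hn0 : (n : ℝ) ≠ 0 := by exact_mod_cast hn.ne'
  have hn' : (0 : ℝ) < n := by exact_mod_cast hn
  rw [Nat.card_coe_set_eq,
    ← Set.ncard_image_of_injective _ (smul_right_injective Plane hn0)]
  congr 1
  ext x
  constructor
  · rintro ⟨y, ⟨hy, l, hl, rfl⟩, rfl⟩
    simp only [smul_inv_smul₀ hn0]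
    refine ⟨hl, fun i => ?_⟩
    have := hy i
    simp only [PiLp.smul_apply, smul_eq_mul, Set.mem_Icc, neg_le_iff_add_nonneg,
      inv_mul_le_iff₀ hn', mul_one] at this ⊢
    refine ⟨?_, this.2⟩
    have h := mul_nonneg hn'.le this.1
    rw [mul_add, mul_inv_cancel_left₀ hn0] at h
    linarith
  · rintro ⟨hl, hs⟩
    refine ⟨(n : ℝ)⁻¹ • x, ⟨fun i => ?_, x, hl, rfl⟩, smul_inv_smul₀ hn0 x⟩
    have := hs i
    simp only [PiLp.smul_apply, smul_eq_mul, Set.mem_Icc, inv_mul_le_iff₀ hn', mul_one] at this ⊢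
    refine ⟨?_, this.2⟩
    rw [le_inv_mul_iff₀ hn']
    linarith

section Periodic

variable {ι : Type*} (b : Module.Basis (Fin 2) ℝ Plane) (p : ι → Plane) (ρ : ι → ℝ)

lemma periodicDiscs_inter_square_subset {c : ℝ} (hc : ∀ i, ‖p i‖ + ρ i ≤ c) {k : ℝ} {i : ι}
    {l : Plane} (hl : l ∈ Submodule.span ℤ (Set.range b)) (hk : l ∈ square k) :
    Metric.ball (p i + l) (ρ i) ⊆ covered (periodicDiscs b p ρ) ∩ square (k + c) := by
  intro x hx
  refine ⟨?_, fun j => ?_⟩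
  · have hd : (p i + l, ρ i) ∈ periodicDiscs b p ρ := ⟨i, l, hl, rfl⟩
    exact Set.mem_iUnion₂.2 ⟨_, hd, Metric.ball_subset_closedBall hx⟩
  · have h1 : |x j - l j| ≤ c := by
      refine (PiLp.norm_apply_le (x - l) j).trans ?_
      have h3 : ‖x - (p i + l)‖ < ρ i := by simpa [dist_eq_norm] using hx
      have h4 : x - l = (x - (p i + l)) + p i := by abel
      rw [h4]
      linarith [norm_add_le (x - (p i + l)) (p i), hc i]
    have h5 := hk j
    rw [abs_le] at h1
    exact ⟨by linarith [h5.1], by linarith [h5.2]⟩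

lemma disjoint_ball_periodicDiscs
    (hsep : ∀ i j, ∀ l ∈ Submodule.span ℤ (Set.range b), (i = j → l ≠ 0) →
      ρ i + ρ j ≤ dist (p i + l) (p j)) {i j : ι} {l l' : Plane}
    (hl : l ∈ Submodule.span ℤ (Set.range b)) (hl' : l' ∈ Submodule.span ℤ (Set.range b))
    (hne : i = j → l ≠ l') :
    Disjoint (Metric.ball (p i + l) (ρ i)) (Metric.ball (p j + l') (ρ j)) := by
  refine Metric.ball_disjoint_ball ?_
  have := hsep i j (l - l') (sub_mem hl hl') fun h => sub_ne_zero.2 (hne h)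
  rw [dist_eq_norm] at this ⊢
  rwa [show p i + l - (p j + l') = p i + (l - l') - p j by abel]

lemma card_mul_le_volume_covered [Fintype ι] {c : ℝ} (hc : ∀ i, ‖p i‖ + ρ i ≤ c) (hρ : ∀ i, 0 < ρ i)
    (hsep : ∀ i j, ∀ l ∈ Submodule.span ℤ (Set.range b), (i = j → l ≠ 0) →
      ρ i + ρ j ≤ dist (p i + l) (p j)) (k : ℝ) :
    ((Submodule.span ℤ (Set.range b) : Set Plane) ∩ square k).ncard * ∑ i, Real.pi * ρ i ^ 2
      ≤ volume.real (covered (periodicDiscs b p ρ) ∩ square (k + c)) := by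
  have hfin : ((Submodule.span ℤ (Set.range b) : Set Plane) ∩ square k).Finite := by
    rw [Set.inter_comm]
    exact ZSpan.setFinite_inter b (isCompact_square k).isBounded
  have hdisj : Set.PairwiseDisjoint (↑((Finset.univ : Finset ι) ×ˢ hfin.toFinset))
      (fun t : ι × Plane => Metric.ball (p t.1 + t.2) (ρ t.1)) := by
    rintro ⟨i, l⟩ hil ⟨j, l'⟩ hjl hne
    simp only [Finset.coe_product, Set.mem_prod, Finset.mem_coe, Set.Finite.mem_toFinset]
      at hil hjl
    exact disjoint_ball_periodicDiscs b p ρ hsep hil.2.1 hjl.2.1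
      fun h h' => hne (Prod.ext h h')
  have hsub : (⋃ t ∈ (Finset.univ : Finset ι) ×ˢ hfin.toFinset,
      Metric.ball (p t.1 + t.2) (ρ t.1)) ⊆ covered (periodicDiscs b p ρ) ∩ square (k + c) := by
    refine Set.iUnion₂_subset ?_
    rintro ⟨i, l⟩ hil
    simp only [Finset.mem_product, Set.Finite.mem_toFinset] at hil
    exact periodicDiscs_inter_square_subset b p ρ hc hil.2.1 hil.2.2
  refine le_trans (le_of_eq ?_) (measureReal_mono (μ := volume) hsub
    (measure_ne_top_of_subset Set.inter_subset_right (isCompact_square _).measure_ne_top))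
  rw [measureReal_biUnion_finset hdisj (fun _ _ => measurableSet_ball)
      (fun _ _ => measure_ball_lt_top.ne), Finset.sum_product_right]
  simp only
  have hvol : ∀ (x : Plane) i, volume.real (Metric.ball x (ρ i)) = Real.pi * ρ i ^ 2 := by
    intro x i
    rw [measureReal_def, EuclideanSpace.volume_ball_fin_two, ENNReal.toReal_mul,
      ENNReal.toReal_pow, ENNReal.toReal_ofReal (hρ i).le, mul_comm]
    simp [Real.pi_pos.le]
  simp only [hvol]
  rw [Finset.sum_const, nsmul_eq_mul, Set.ncard_eq_toFinset_card _ hfin]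

/-- The density of a periodic packing is at least the area of its discs in a cell, divided by
the area of the cell: up to a boundary term, the square `[-k, k]²` contains
`4 k² / covolume` translates of these discs. -/
lemma le_density_periodicDiscs [Fintype ι] (hρ : ∀ i, 0 < ρ i)
    (hsep : ∀ i j, ∀ l ∈ Submodule.span ℤ (Set.range b), (i = j → l ≠ 0) →
      ρ i + ρ j ≤ dist (p i + l) (p j)) :
    (∑ i, Real.pi * ρ i ^ 2) / |b 0 0 * b 1 1 - b 0 1 * b 1 0|
      ≤ density (periodicDiscs b p ρ) := by
  obtain ⟨c, hc⟩ : ∃ c : ℝ, ∀ i, ‖p i‖ + ρ i ≤ c := by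
    obtain ⟨c, hc⟩ := (Set.finite_range fun i => ‖p i‖ + ρ i).bddAbove
    exact ⟨c, fun i => hc ⟨i, rfl⟩⟩
  have hcard := ZLattice.covolume.tendsto_card_div_pow' (Submodule.span ℤ (Set.range b))
    (s := square 1) (isCompact_square 1).isBounded (isCompact_square 1).measurableSet
    ((convex_square 1).addHaar_frontier volume)
  rw [covolume_span, volume_real_square zero_le_one] at hcard
  simp only [finrank_euclideanSpace, Fintype.card_fin] at hcard
  have hmain := card_mul_le_volume_covered b p ρ hc hρ hsep
  generalize (∑ i, Real.pi * ρ i ^ 2) = a at hmain ⊢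
  generalize |b 0 0 * b 1 1 - b 0 1 * b 1 0| = A at hcard ⊢
  have h1 : Tendsto (fun n : ℕ => ((n : ℝ) / (n + c))) atTop (nhds 1) :=
    tendsto_natCast_div_add_atTop c
  have h2 := hcard.mul ((h1.pow 2).const_mul (a / 4))
  rw [show (2 * 1) ^ 2 / A * (a / 4 * 1 ^ 2) = a / A by ring] at h2
  refine le_density_of_tendsto (k := fun n : ℕ => (n : ℝ) + c)
    (tendsto_atTop_add_const_right _ _ tendsto_natCast_atTop_atTop) h2 ?_
  filter_upwards [eventually_gt_atTop 0,
    (tendsto_natCast_atTop_atTop (R := ℝ)).eventually_gt_atTop (-c)] with n hn hn2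
  have hn0 : (0 : ℝ) < n := by exact_mod_cast hn
  have hnc : (0 : ℝ) < n + c := by linarith
  rw [volume_real_square hnc.le, card_square_inter_smul _ hn, le_div_iff₀ (by positivity)]
  refine le_trans (le_of_eq ?_) (hmain n)
  field_simp
  ring

end Periodic

/-- A periodic packing beats the hexagonal packing as soon as its cell, spanned by `(u₁, u₂)` and
`(v₁, v₂)`, has area less than `2 √3` times the sum of the squares of the radii of the discs
with centres `(x i, y i)` that it contains up to translation. -/
theorem hexDensity_lt_maxDensity_of_periodic {N : ℕ} {r u₁ u₂ v₁ v₂ : ℝ} {x y ρ : Fin N → ℝ}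
    (hr : 0 < r) (hρ : ∀ i, ρ i = 1 ∨ ρ i = r) (hdet : 0 < u₁ * v₂ - u₂ * v₁)
    (hsep : ∀ i j, i ≤ j → ∀ m n : ℤ, (i = j → m ≠ 0 ∨ n ≠ 0) → (ρ i + ρ j) ^ 2 ≤
      (x i - x j + m * u₁ + n * v₁) ^ 2 + (y i - y j + m * u₂ + n * v₂) ^ 2)
    (harea : u₁ * v₂ - u₂ * v₁ < 2 * √3 * ∑ i, ρ i ^ 2) : hexDensity < maxDensity r := by
  have hsep' : ∀ i j, ∀ m n : ℤ, (i = j → m ≠ 0 ∨ n ≠ 0) → (ρ i + ρ j) ^ 2 ≤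
      (x i - x j + m * u₁ + n * v₁) ^ 2 + (y i - y j + m * u₂ + n * v₂) ^ 2 := by
    intro i j m n h
    rcases le_total i j with hij | hij
    · exact hsep i j hij m n h
    · have h' := hsep j i hij (-m) (-n) fun h' => by simpa using h h'.symm
      push_cast at h'
      linarith
  have hρ0 : ∀ i, 0 < ρ i := fun i => by rcases hρ i with h | h <;> rw [h] <;> linarith
  set u : Plane := !₂[u₁, u₂] with hu
  set v : Plane := !₂[v₁, v₂] with hv
  have hli : LinearIndependent ℝ ![u, v] := by
    rw [LinearIndependent.pair_iff]
    intro s t hst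
    have h0 := congrArg (fun z : Plane => z 0) hst
    have h1 := congrArg (fun z : Plane => z 1) hst
    simp [hu, hv] at h0 h1
    constructor
    · have : s * (u₁ * v₂ - u₂ * v₁) = 0 := by linear_combination v₂ * h0 - v₁ * h1
      exact (mul_eq_zero.1 this).resolve_right hdet.ne'
    · have : t * (u₁ * v₂ - u₂ * v₁) = 0 := by linear_combination u₁ * h1 - u₂ * h0
      exact (mul_eq_zero.1 this).resolve_right hdet.ne'
  let b : Module.Basis (Fin 2) ℝ Plane := basisOfLinearIndependentOfCardEqFinrank hli (by simp)
  have hb : ⇑b = ![u, v] := coe_basisOfLinearIndependentOfCardEqFinrank hli _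
  let p : Fin N → Plane := fun i => !₂[x i, y i]
  have hdist : ∀ i j, ∀ l ∈ Submodule.span ℤ (Set.range b), (i = j → l ≠ 0) →
      ρ i + ρ j ≤ dist (p i + l) (p j) := by
    intro i j l hl hne
    rw [hb, Matrix.range_cons, Matrix.range_cons, Matrix.range_empty, Set.union_empty,
      Set.singleton_union, Submodule.mem_span_pair] at hl
    obtain ⟨m, n, rfl⟩ := hl
    have h := hsep' i j m n fun hij => by
      by_contra! h
      exact hne hij (by simp [h.1, h.2])
    rw [EuclideanSpace.dist_eq, Fin.sum_univ_two]
    refine Real.le_sqrt_of_sq_le (h.trans (le_of_eq ?_))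
    simp [p, hu, hv, Real.dist_eq]
    ring
  have hpack : IsPacking r (periodicDiscs b p ρ) := by
    refine ⟨?_, ?_⟩
    · rintro _ ⟨i, l, -, rfl⟩
      exact hρ i
    · rintro _ ⟨i, l, hl, rfl⟩ _ ⟨j, l', hl', rfl⟩ hne
      exact disjoint_ball_periodicDiscs b p ρ hdist hl hl' fun h h' => hne (by rw [h, h'])
  refine lt_of_lt_of_le ?_
    ((le_density_periodicDiscs b p ρ hρ0 hdist).trans (density_le_maxDensity hpack))
  have hA : b 0 0 * b 1 1 - b 0 1 * b 1 0 = u₁ * v₂ - u₂ * v₁ := by simp [hb, hu, hv]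
  rw [hA, abs_of_pos hdet, ← Finset.mul_sum, hexDensity, div_lt_div_iff₀ (by positivity) hdet]
  nlinarith [mul_lt_mul_of_pos_left harea Real.pi_pos]

/-! ### Packings given by tables of integers -/

/-- A cell of a periodic packing in units of `10⁻⁵`: a basis `(u₁, u₂)`, `(v₁, v₂)` of the lattice,
and the discs of the cell, each given by its centre and by whether it is large. The radius of a
small disc is at most `hi`, while the packing is meant for small radii between `lo` and `hi`. -/
structure Cell (N : ℕ) where
  lo : ℕ
  hi : ℕ
  u₁ : ℤ
  u₂ : ℤ
  v₁ : ℤ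
  v₂ : ℤ
  disc : Fin N → ℤ × ℤ × Bool

namespace Cell

variable {N : ℕ} (C : Cell N)

/-- The abscissa of the centre of a disc. -/
def x (i : Fin N) : ℤ := (C.disc i).1

/-- The ordinate of the centre of a disc. -/
def y (i : Fin N) : ℤ := (C.disc i).2.1

/-- Whether a disc is large. -/
def large (i : Fin N) : Bool := (C.disc i).2.2

/-- The greatest admissible radius of a disc. -/
def rad (i : Fin N) : ℕ := bif C.large i then 100000 else C.hi

/-- The radius of a disc when small discs have radius `r`. -/
def ρ (r : ℝ) (i : Fin N) : ℝ := bif C.large i then 1 else r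

/-- The determinant of the lattice basis. -/
def det : ℤ := C.u₁ * C.v₂ - C.u₂ * C.v₁

/-- The disc `i`, translated by `m u + n v`, stays clear of the disc `j`, even if all coordinates
of the centres and of the lattice basis are perturbed by up to `E`. The subtractions truncate. -/
def Near (E : ℕ) (i j : Fin N) (m n : ℤ) : Prop :=
  (C.rad i + C.rad j) ^ 2 ≤
    ((C.x i - C.x j + m * C.u₁ + n * C.v₁).natAbs - E * (2 + m.natAbs + n.natAbs)) ^ 2 +
    ((C.y i - C.y j + m * C.u₂ + n * C.v₂).natAbs - E * (2 + m.natAbs + n.natAbs)) ^ 2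

instance (E : ℕ) (i j : Fin N) (m n : ℤ) : Decidable (C.Near E i j m n) :=
  inferInstanceAs (Decidable (_ ≤ _))

/-- A lower bound, stable under perturbations by up to `E`, for the absolute value of the cross
product with `(w₁, w₂)`, one of the two basis vectors, of the difference between the centre of `j`
and that of a translate of `i` by at least three times the other basis vector. -/
def cross (E : ℕ) (w₁ w₂ : ℤ) (i j : Fin N) : ℤ :=
  3 * (C.det - E * (|C.u₁| + |C.u₂| + |C.v₁| + |C.v₂| + 2 * E))
    - (|(C.x i - C.x j) * w₂ - (C.y i - C.y j) * w₁|
      + E * (|C.x i - C.x j| + |C.y i - C.y j| + 2 * |w₁| + 2 * |w₂| + 4 * E))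

/-- The translates of `i` by at least three times the other basis vector stay clear of `j`. -/
def Far (E : ℕ) (w₁ w₂ : ℤ) (i j : Fin N) : Prop :=
  0 ≤ C.cross E w₁ w₂ i j ∧ (C.rad i + C.rad j : ℤ) ^ 2 * ((|w₁| + E) ^ 2 + (|w₂| + E) ^ 2) ≤
    C.cross E w₁ w₂ i j ^ 2

instance (E : ℕ) (w₁ w₂ : ℤ) (i j : Fin N) : Decidable (C.Far E w₁ w₂ i j) :=
  inferInstanceAs (Decidable (_ ∧ _))

end Cell

lemma abs_mul_sub_mul_le {a b a₀ b₀ e f : ℝ} (ha : |a - a₀| ≤ e) (hb : |b - b₀| ≤ f) :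
    |a * b - a₀ * b₀| ≤ e * |b₀| + f * |a₀| + e * f := by
  have h : a * b - a₀ * b₀ = (a - a₀) * b₀ + (b - b₀) * a₀ + (a - a₀) * (b - b₀) := by ring
  have he : 0 ≤ e := (abs_nonneg _).trans ha
  rw [h]
  refine (abs_add_three _ _ _).trans ?_
  rw [abs_mul, abs_mul, abs_mul]
  gcongr

lemma abs_sub_sub_sub_le {a b a₀ b₀ e f : ℝ} (ha : |a - a₀| ≤ e) (hb : |b - b₀| ≤ f) :
    |a - b - (a₀ - b₀)| ≤ e + f := by
  rw [abs_le] at *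
  constructor <;> linarith

/-- The norm of `(p, q)` is at least its cross product with `(w₁, w₂)`, divided by the norm of the
latter. -/
lemma sq_le_of_cross {p q w₁ w₂ c s W : ℝ} (hc : 0 ≤ c) (hcross : c ≤ |p * w₂ - q * w₁|)
    (hW : w₁ ^ 2 + w₂ ^ 2 ≤ W) (hW0 : 0 < W) (h : s ^ 2 * W ≤ c ^ 2) : s ^ 2 ≤ p ^ 2 + q ^ 2 := by
  have h1 : c ^ 2 ≤ (p * w₂ - q * w₁) ^ 2 := by
    rw [← sq_abs (p * w₂ - q * w₁)]
    gcongr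
  have h2 : (p * w₂ - q * w₁) ^ 2 ≤ (p ^ 2 + q ^ 2) * (w₁ ^ 2 + w₂ ^ 2) := by
    nlinarith [sq_nonneg (p * w₁ + q * w₂)]
  have h3 : (p ^ 2 + q ^ 2) * (w₁ ^ 2 + w₂ ^ 2) ≤ (p ^ 2 + q ^ 2) * W := by gcongr
  exact le_of_mul_le_mul_right (h.trans (h1.trans (h2.trans h3))) hW0

lemma sq_natAbs_sub_le {a : ℝ} {a₀ : ℤ} {e : ℕ} (h : |a - a₀| ≤ e) :
    ((a₀.natAbs - e : ℕ) : ℝ) ^ 2 ≤ a ^ 2 := by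
  rw [← sq_abs a]
  gcongr
  rcases le_total a₀.natAbs e with h' | h'
  · simp [Nat.sub_eq_zero_of_le h']
  · rw [Nat.cast_sub h', Nat.cast_natAbs, Int.cast_abs]
    have := abs_sub_abs_le_abs_sub (a₀ : ℝ) a
    rw [abs_sub_comm] at this
    linarith

namespace Cell

/-- The real data `u₁`, …, `y`, in units of `10⁻⁵`, are within `E` of the integers in the
table `C`. -/
structure Approx {N : ℕ} (C : Cell N) (E : ℕ) (u₁ u₂ v₁ v₂ : ℝ) (x y : Fin N → ℝ) : Prop where
  u₁ : |u₁ - C.u₁| ≤ E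
  u₂ : |u₂ - C.u₂| ≤ E
  v₁ : |v₁ - C.v₁| ≤ E
  v₂ : |v₂ - C.v₂| ≤ E
  x : ∀ i, |x i - C.x i| ≤ E
  y : ∀ i, |y i - C.y i| ≤ E

variable {N : ℕ} {C : Cell N} {E : ℕ} {u₁ u₂ v₁ v₂ : ℝ} {x y : Fin N → ℝ}

lemma Approx.abs_translate_sub_le {a b : ℝ} {a₀ b₀ : ℤ} {z : Fin N → ℝ}
    {z₀ : Fin N → ℤ} (ha : |a - a₀| ≤ E) (hb : |b - b₀| ≤ E)
    (hz : ∀ i, |z i - z₀ i| ≤ E) (i j : Fin N) (m n : ℤ) :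
    |z i - z j + m * a + n * b - (z₀ i - z₀ j + m * a₀ + n * b₀ : ℤ)|
      ≤ (E * (2 + m.natAbs + n.natAbs) : ℕ) := by
  have h : z i - z j + m * a + n * b - (z₀ i - z₀ j + m * a₀ + n * b₀ : ℤ)
      = (z i - z j - (z₀ i - z₀ j)) + m * (a - a₀) + n * (b - b₀) := by
    push_cast
    ring
  rw [h]
  refine (abs_add_three _ _ _).trans ?_
  rw [abs_mul, abs_mul]
  push_cast [Nat.cast_natAbs]
  have h1 := abs_sub_sub_sub_le (hz i) (hz j)
  have h2 : |(m : ℝ)| * |a - a₀| ≤ |(m : ℝ)| * E := by gcongr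
  have h3 : |(n : ℝ)| * |b - b₀| ≤ |(n : ℝ)| * E := by gcongr
  linarith

lemma Near.le (h : C.Approx E u₁ u₂ v₁ v₂ x y) {i j : Fin N} {m n : ℤ}
    (hn : C.Near E i j m n) : ((C.rad i + C.rad j : ℕ) : ℝ) ^ 2 ≤
      (x i - x j + m * u₁ + n * v₁) ^ 2 + (y i - y j + m * u₂ + n * v₂) ^ 2 := by
  have h1 := sq_natAbs_sub_le (Approx.abs_translate_sub_le h.u₁ h.v₁ h.x i j m n)
  have h2 := sq_natAbs_sub_le (Approx.abs_translate_sub_le h.u₂ h.v₂ h.y i j m n)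
  refine le_trans ?_ (add_le_add h1 h2)
  exact_mod_cast hn

lemma Approx.abs_det_sub_le (h : C.Approx E u₁ u₂ v₁ v₂ x y) :
    |u₁ * v₂ - u₂ * v₁ - C.det| ≤
      E * (|(C.u₁ : ℝ)| + |(C.u₂ : ℝ)| + |(C.v₁ : ℝ)| + |(C.v₂ : ℝ)| + 2 * E) := by
  have h1 := abs_sub_sub_sub_le (abs_mul_sub_mul_le h.u₁ h.v₂) (abs_mul_sub_mul_le h.u₂ h.v₁)
  refine le_trans (le_of_eq ?_) (h1.trans (le_of_eq ?_))
  · simp [Cell.det]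
  · ring

/-- If the multiple `k` of the basis vector other than `w` is at least three, then `cross` bounds
the cross product with `w` from below. -/
lemma Approx.cross_le (h : C.Approx E u₁ u₂ v₁ v₂ x y) {w₁ w₂ : ℝ} {w₁' w₂' : ℤ}
    (hw₁ : |w₁ - w₁'| ≤ E) (hw₂ : |w₂ - w₂'| ≤ E) (i j : Fin N) {k : ℤ}
    (hk : 3 ≤ |k|) (h0 : 0 ≤ C.cross E w₁' w₂' i j) :
    (C.cross E w₁' w₂' i j : ℝ) ≤
      |k * (u₁ * v₂ - u₂ * v₁) + ((x i - x j) * w₂ - (y i - y j) * w₁)| := by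
  have hdet := h.abs_det_sub_le
  have hd := abs_sub_sub_sub_le
    (abs_mul_sub_mul_le (abs_sub_sub_sub_le (h.x i) (h.x j)) hw₂)
    (abs_mul_sub_mul_le (abs_sub_sub_sub_le (h.y i) (h.y j)) hw₁)
  set D := u₁ * v₂ - u₂ * v₁
  set X := (x i - x j) * w₂ - (y i - y j) * w₁
  have hk' : (3 : ℝ) ≤ |(k : ℝ)| := by exact_mod_cast hk
  have h0' : (0 : ℝ) ≤ C.cross E w₁' w₂' i j := by exact_mod_cast h0
  have hc : (C.cross E w₁' w₂' i j : ℝ) = 3 * ((C.det : ℝ) -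
      E * (|(C.u₁ : ℝ)| + |(C.u₂ : ℝ)| + |(C.v₁ : ℝ)| + |(C.v₂ : ℝ)| + 2 * E))
      - (|((C.x i : ℝ) - C.x j) * w₂' - (C.y i - C.y j) * w₁'|
      + E * (|(C.x i : ℝ) - C.x j| + |(C.y i : ℝ) - C.y j| + 2 * |(w₁' : ℝ)| + 2 * |(w₂' : ℝ)|
        + 4 * E)) := by
    simp [Cell.cross]
  have hX : |X| ≤ |((C.x i : ℝ) - C.x j) * w₂' - (C.y i - C.y j) * w₁'|
      + E * (|(C.x i : ℝ) - C.x j| + |(C.y i : ℝ) - C.y j| + 2 * |(w₁' : ℝ)| + 2 * |(w₂' : ℝ)|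
        + 4 * E) := by
    have := abs_sub_abs_le_abs_sub X (((C.x i : ℝ) - C.x j) * w₂' - (C.y i - C.y j) * w₁')
    linarith
  have hD := (abs_le.1 hdet).1
  have hD0 : 0 ≤ D := by
    have := (abs_nonneg X).trans hX
    linarith
  have h1 : 3 * D ≤ |k * D| := by
    rw [abs_mul, abs_of_nonneg hD0]
    gcongr
  have h2 := abs_sub_abs_le_abs_add (k * D) X
  linarith

lemma Far.le (h : C.Approx E u₁ u₂ v₁ v₂ x y) {w₁ w₂ : ℝ} {w₁' w₂' : ℤ}
    (hw₁ : |w₁ - w₁'| ≤ E) (hw₂ : |w₂ - w₂'| ≤ E) {i j : Fin N}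
    (hf : C.Far E w₁' w₂' i j) (hW : 0 < w₁ ^ 2 + w₂ ^ 2) {k : ℤ} (hk : 3 ≤ |k|) {p q : ℝ}
    (hpq : |p * w₂ - q * w₁|
      = |k * (u₁ * v₂ - u₂ * v₁) + ((x i - x j) * w₂ - (y i - y j) * w₁)|) :
    ((C.rad i + C.rad j : ℕ) : ℝ) ^ 2 ≤ p ^ 2 + q ^ 2 := by
  have hb : ∀ {w : ℝ} {w' : ℤ}, |w - w'| ≤ E → w ^ 2 ≤ (|(w' : ℝ)| + E) ^ 2 := by
    intro w w' hw
    rw [← sq_abs w]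
    gcongr
    linarith [abs_sub_abs_le_abs_sub w w']
  have hle := add_le_add (hb hw₁) (hb hw₂)
  refine sq_le_of_cross (by exact_mod_cast hf.1) (hpq ▸ h.cross_le hw₁ hw₂ i j hk hf.1) hle
    (hW.trans_le hle) ?_
  exact_mod_cast hf.2

/-- The multiples of the basis vectors for which the distances are checked one by one. -/
def shifts : List ℤ := [-2, -1, 0, 1, 2]

lemma mem_shifts {m : ℤ} (h : |m| < 3) : m ∈ shifts := by
  rw [abs_lt] at h
  obtain ⟨h1, h2⟩ := h
  simp only [shifts, List.mem_cons, List.not_mem_nil]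
  omega

/-- Every two discs of a cell, up to translation, pass the test `Near` or belong to the list `K` of
contacts, and far translates pass the test `Far`. -/
def Stable (C : Cell N) (E : ℕ) (K : List (Fin N × Fin N × ℤ × ℤ)) : Prop :=
  (∀ i j, i ≤ j → ∀ m ∈ shifts, ∀ n ∈ shifts,
    (i = j ∧ m = 0 ∧ n = 0) ∨ C.Near E i j m n ∨ (i, j, m, n) ∈ K) ∧
  (∀ i j, C.Far E C.u₁ C.u₂ i j ∧ C.Far E C.v₁ C.v₂ i j)

instance (C : Cell N) (E : ℕ) (K : List (Fin N × Fin N × ℤ × ℤ)) :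
    Decidable (C.Stable E K) := inferInstanceAs (Decidable (_ ∧ _))

lemma Approx.separation (h : C.Approx E u₁ u₂ v₁ v₂ x y)
    (hfar : ∀ i j, C.Far E C.u₁ C.u₂ i j ∧ C.Far E C.v₁ C.v₂ i j)
    (hdet : 0 < u₁ * v₂ - u₂ * v₁) (i j : Fin N) (m n : ℤ)
    (hnear : m ∈ shifts → n ∈ shifts → C.Near E i j m n) :
    ((C.rad i + C.rad j : ℕ) : ℝ) ^ 2 ≤
      (x i - x j + m * u₁ + n * v₁) ^ 2 + (y i - y j + m * u₂ + n * v₂) ^ 2 := by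
  have hpos : ∀ {a b c d : ℝ}, a * b - c * d ≠ 0 → 0 < a ^ 2 + c ^ 2 := by
    intro a b c d hne
    by_contra! hcon
    have ha : a = 0 := by nlinarith [sq_nonneg a, sq_nonneg c]
    have hc : c = 0 := by nlinarith [sq_nonneg a, sq_nonneg c]
    simp [ha, hc] at hne
  by_cases hm : 3 ≤ |m|
  · refine Far.le h h.v₁ h.v₂ (hfar i j).2 (hpos (b := u₂) (d := u₁) ?_) hm ?_
    · intro h0
      linarith
    · congr 1
      ring
  by_cases hn : 3 ≤ |n|
  · refine Far.le h h.u₁ h.u₂ (hfar i j).1 (hpos (b := v₂) (d := v₁) hdet.ne')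
      (k := -n) (by rwa [abs_neg]) ?_
    · congr 1
      push_cast
      ring
  exact (hnear (mem_shifts (not_le.1 hm)) (mem_shifts (not_le.1 hn))).le h

lemma ρ_le_rad (C : Cell N) {r : ℝ} (hr : r ≤ C.hi / 100000) (i : Fin N) :
    C.ρ r i ≤ (C.rad i : ℝ) / 100000 := by
  cases h : C.large i <;> simp [ρ, rad, h, hr]

lemma ρ_nonneg (C : Cell N) {r : ℝ} (hr : 0 ≤ r) (i : Fin N) : 0 ≤ C.ρ r i := by
  cases h : C.large i <;> simp [ρ, h, hr]

/-- A periodic packing is obtained from real data close to those of a table, if only the distances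
of the discs in contact are known exactly, and all others are checked on the table. -/
lemma Stable.hexDensity_lt_maxDensity {C : Cell N} {E : ℕ}
    {K : List (Fin N × Fin N × ℤ × ℤ)} (hC : C.Stable E K)
    {r u₁ u₂ v₁ v₂ : ℝ} {x y : Fin N → ℝ}
    (happ : C.Approx E (100000 * u₁) (100000 * u₂) (100000 * v₁) (100000 * v₂)
      (fun i => 100000 * x i) (fun i => 100000 * y i))
    (hr : 0 < r) (hr' : r ≤ (C.hi : ℝ) / 100000)
    (hK : ∀ t ∈ K, (C.ρ r t.1 + C.ρ r t.2.1) ^ 2 ≤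
      (x t.1 - x t.2.1 + t.2.2.1 * u₁ + t.2.2.2 * v₁) ^ 2 +
      (y t.1 - y t.2.1 + t.2.2.1 * u₂ + t.2.2.2 * v₂) ^ 2)
    (hdet : 0 < u₁ * v₂ - u₂ * v₁)
    (harea : u₁ * v₂ - u₂ * v₁ < 2 * √3 * ∑ i, C.ρ r i ^ 2) : hexDensity < maxDensity r := by
  refine hexDensity_lt_maxDensity_of_periodic (x := x) (y := y) hr (fun i => ?_) hdet
    (fun i j hij m n hne => ?_) harea
  · cases h : C.large i <;> simp [ρ, h]
  by_cases hmem : (i, j, m, n) ∈ K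
  · exact hK _ hmem
  have h1 := happ.separation hC.2 (by linarith) i j m n fun hm hn => by
    rcases hC.1 i j hij m hm n hn with h | h | h
    · exact absurd (hne h.1) (by simp [h.2])
    · exact h
    · exact absurd h hmem
  have h2 : (100000 * (C.ρ r i + C.ρ r j)) ^ 2 ≤ ((C.rad i + C.rad j : ℕ) : ℝ) ^ 2 := by
    have := C.ρ_le_rad hr' i
    have := C.ρ_le_rad hr' j
    have := C.ρ_nonneg hr.le i
    have := C.ρ_nonneg hr.le j
    push_cast
    gcongr
    linarith
  linarith

/-- The table gives a packing for every small radius up to `hi`, and this packing beats the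
hexagonal one for every small radius from `lo` on. -/
def Valid (C : Cell N) : Prop :=
  C.Stable 0 [] ∧ 0 < C.det ∧ C.det * 10000000 <
    34641016 * ∑ i, bif C.large i then 10000000000 else (C.lo : ℤ) ^ 2

instance (C : Cell N) : Decidable C.Valid := inferInstanceAs (Decidable (_ ∧ _ ∧ _))

lemma Valid.hexDensity_lt (hC : C.Valid) {r : ℝ} (hr0 : 0 < r) (h1 : (C.lo : ℝ) / 100000 ≤ r)
    (h2 : r ≤ (C.hi : ℝ) / 100000) : hexDensity < maxDensity r := by
  obtain ⟨hstable, hdet, harea⟩ := hC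
  have hdet' : (0 : ℝ) < C.u₁ * C.v₂ - C.u₂ * C.v₁ := by exact_mod_cast hdet
  have hd : (C.u₁ : ℝ) / 100000 * (C.v₂ / 100000) - C.u₂ / 100000 * (C.v₁ / 100000)
      = (C.u₁ * C.v₂ - C.u₂ * C.v₁) / 10000000000 := by ring
  refine hstable.hexDensity_lt_maxDensity (u₁ := C.u₁ / 100000) (u₂ := C.u₂ / 100000)
    (v₁ := C.v₁ / 100000) (v₂ := C.v₂ / 100000) (x := fun i => C.x i / 100000)
    (y := fun i => C.y i / 100000) ?_ hr0 h2 (by simp) (by rw [hd]; positivity) ?_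
  · constructor <;> simp [mul_div_cancel₀]
  · rw [hd]
    have hs : ((∑ i, bif C.large i then 10000000000 else (C.lo : ℤ) ^ 2 : ℤ) : ℝ)
        ≤ 10000000000 * ∑ i, C.ρ r i ^ 2 := by
      have hsq : ((C.lo : ℝ) / 100000) ^ 2 ≤ r ^ 2 := by gcongr
      rw [Int.cast_sum, Finset.mul_sum]
      refine Finset.sum_le_sum fun i _ => ?_
      cases h : C.large i
      · simp only [ρ, h, cond_false, Int.cast_pow, Int.cast_natCast]
        linarith
      · simp [ρ, h]
    have ha : (C.u₁ * C.v₂ - C.u₂ * C.v₁ : ℝ) * 10000000 <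
        34641016 * ((∑ i, bif C.large i then 10000000000 else (C.lo : ℤ) ^ 2 : ℤ) : ℝ) := by
      exact_mod_cast harea
    have h3 : (1.7320508 : ℝ) ≤ √3 := Real.le_sqrt_of_sq_le (by norm_num)
    generalize ∑ i, C.ρ r i ^ 2 = s at hs ⊢
    have : 0 < s := by linarith
    nlinarith

/-- The intervals `[lo, hi]` of the cells of a list form a chain that covers everything from `a` up
to the end of the last interval. -/
def Covers : ℕ → List (Σ N, Cell N) → ℕ → Prop
  | a, [], b => b ≤ a
  | a, C :: l, b => C.2.lo ≤ a ∧ Covers C.2.hi l b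

instance decidableCovers : ∀ (a : ℕ) (l : List (Σ N, Cell N)) (b : ℕ), Decidable (Covers a l b)
  | a, [], b => inferInstanceAs (Decidable (b ≤ a))
  | a, C :: l, b =>
    have := decidableCovers C.2.hi l b
    inferInstanceAs (Decidable (C.2.lo ≤ a ∧ Covers C.2.hi l b))

lemma Covers.hexDensity_lt {l : List (Σ N, Cell N)} (hl : ∀ C ∈ l, C.2.Valid) :
    ∀ {a b : ℕ}, Covers a l b → ∀ {r : ℝ}, 0 < r → (a : ℝ) / 100000 ≤ r →
      r < (b : ℝ) / 100000 → hexDensity < maxDensity r := by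
  induction l with
  | nil =>
    intro a b h r _ h1 h2
    have : (b : ℝ) ≤ a := by exact_mod_cast h
    linarith
  | cons C l ih =>
    intro a b h r h0 h1 h2
    rcases le_total r ((C.2.hi : ℝ) / 100000) with h3 | h3
    · refine (hl C (by simp)).hexDensity_lt h0 (le_trans ?_ h1) h3
      have : (C.2.lo : ℝ) ≤ a := by exact_mod_cast h.1
      linarith
    · exact ih (fun D hD => hl D (by simp [hD])) h.2 h0 h3 h2

end Cell

/-! ### Tables for radii away from the five roots -/

/-- Cells of periodic packings for small radii between `0.15000` and `0.43250`. -/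
def cellsA : List (Σ N, Cell N) :=
  [ ⟨6, 12121, 17319, 340952, 0, 0, 209172, ![(0, 0, true), (170476, 104586, true),
      (-53157, 104586, false), (117319, 0, false), (53157, 104586, false), (-117319, 0, false)]⟩,
    ⟨6, 17319, 19666, 219700, 0, 0, 334265, ![(0, 0, true), (109850, 167132, true),
      (0, 119666, false), (109850, -47466, false), (109850, 47466, false), (0, -119666, false)]⟩,
    ⟨5, 19666, 21610, 200000, 0, 0, 200000, ![(0, 0, true), (100000, 69409, false),
      (69409, 100000, false), (-69409, 100000, false), (100000, -69409, false)]⟩,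
    ⟨6, 21610, 23020, 232976, 0, 0, 325152, ![(0, 0, true), (116488, 162576, true),
      (0, -123021, false), (0, 123021, false), (116488, 39555, false), (116488, -39555, false)]⟩,
    ⟨6, 23020, 24638, 392442, 0, 43330, 195251, ![(0, 0, true), (217886, 97626, true),
      (123592, 16118, false), (-123592, -16118, false), (94294, 81508, false),
      (-94294, -81508, false)]⟩,
    ⟨6, 24638, 27080, 246830, 0, 0, 314763, ![(0, 0, true), (123415, 157382, true),
      (0, -127080, false), (0, 127080, false), (123415, 30301, false), (123415, -30301, false)]⟩,
    ⟨6, 27080, 29013, 389756, 0, 0, 203828, ![(0, 0, true), (194878, -44977, true),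
      (115770, 56937, false), (79108, 101914, false), (-115770, 56937, false),
      (-79108, 101914, false)]⟩,
    ⟨6, 29013, 30047, 253058, 0, 0, 319870, ![(0, 0, true), (120088, 159935, true),
      (-6441, 129888, false), (-6441, -129888, false), (126529, -30047, false),
      (126529, 30047, false)]⟩,
    ⟨6, 30047, 30639, 253993, 0, -16709, 322024, ![(0, 0, true), (118642, 161012, true),
      (126997, -30639, false), (-126997, 30639, false), (8355, -130373, false),
      (-8355, 130373, false)]⟩,
    ⟨6, 30639, 30991, 323278, 0, 0, 254546, ![(0, 0, true), (161639, -117785, true),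
      (30991, 127273, false), (-30991, 127273, false), (130648, 9488, false),
      (-130648, 9488, false)]⟩,
    ⟨6, 30991, 31205, 324032, 0, 0, 254882, ![(0, 0, true), (162016, 117266, true),
      (130811, -10175, false), (31205, 127441, false), (-130811, -10175, false),
      (-31205, 127441, false)]⟩,
    ⟨10, 31205, 31367, 259396, 0, -1411, 371118, ![(0, 0, true), (-129698, 152246, true),
      (-129698, 20878, false), (38646, -125555, false), (0, 131368, false),
      (128321, -41841, false), (92463, -93317, false), (2787, -177031, false),
      (-34674, -126709, false), (-93614, -92163, false)]⟩,
    ⟨10, 31367, 31529, 259837, 0, 619, 371569, ![(0, 0, true), (129918, 152059, true),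
      (-1238, -176983, false), (0, 131530, false), (92894, -93117, false),
      (-92368, -93639, false), (129918, 20529, false), (36404, -126392, false),
      (-38169, -125870, false), (-129300, -42527, false)]⟩,
    ⟨10, 31529, 31690, 260211, 0, 0, 372123, ![(0, 0, true), (130105, -152065, true),
      (92332, 93901, false), (130105, 43006, false), (37774, 126157, false), (0, 177052, false),
      (0, -131691, false), (-37774, 126157, false), (130105, -20374, false),
      (-92332, 93901, false)]⟩,
    ⟨10, 31690, 31824, 373102, 0, -781, 260283, ![(0, 0, true), (-152432, -129481, true),
      (177631, 533, false), (126215, 38050, false), (94230, -92188, false),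
      (43040, -130013, false), (93675, 92752, false), (126441, -37292, false),
      (-21390, 130078, false), (-131823, 724, false)]⟩,
    ⟨10, 31824, 31938, 260342, 0, -1904, 373926, ![(0, 0, true), (128267, 153455, true),
      (-1904, 131926, false), (-92588, -93997, false), (-37583, -126473, false),
      (37583, -126473, false), (130171, -42347, false), (92588, -93997, false),
      (-130171, 21530, false), (0, -178123, false)]⟩,
    ⟨7, 31938, 32050, 253930, 0, -126965, 219910, ![(0, 0, true), (126965, -36295, false),
      (-94915, 91808, false), (94915, -91808, false), (-126965, 36295, false),
      (-159015, 91808, false), (159015, -91808, false)]⟩,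
    ⟨7, 32050, 32194, 254268, 0, 127134, 220202, ![(0, 0, true), (127134, 36226, false),
      (94940, 91988, false), (-94940, -91988, false), (-127134, -36226, false),
      (-159328, -91988, false), (159328, 91988, false)]⟩,
    ⟨7, 32194, 32380, 254705, 0, -127352, 220581, ![(0, 0, true), (-127352, 36138, false),
      (-94972, 92222, false), (-159732, 92222, false), (159732, -92222, false),
      (94972, -92222, false), (127352, -36138, false)]⟩,
    ⟨7, 32380, 32620, 255268, 0, 127634, 221069, ![(0, 0, true), (160254, 92523, false),
      (-95014, -92523, false), (95014, 92523, false), (-127634, -36023, false),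
      (127634, 36023, false), (-160254, -92523, false)]⟩,
    ⟨7, 32620, 32933, 256003, 0, -128001, 221705, ![(0, 0, true), (128001, -35874, false),
      (95068, -92916, false), (-128001, 35874, false), (160934, -92916, false),
      (-160934, 92916, false), (-95068, 92916, false)]⟩,
    ⟨7, 32933, 33341, 256960, 0, 128480, 222534, ![(0, 0, true), (-161821, -93428, false),
      (-95139, -93428, false), (-128480, -35679, false), (128480, 35679, false),
      (95139, 93428, false), (161821, 93428, false)]⟩,
    ⟨7, 33341, 33880, 258220, 0, 129110, 223625, ![(0, 0, true), (129110, 35420, false),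
      (-129110, -35420, false), (-162990, -94102, false), (-95230, -94102, false),
      (162990, 94102, false), (95230, 94102, false)]⟩,
    ⟨7, 33880, 34600, 259900, 0, 129950, 225080, ![(0, 0, true), (129950, 35074, false),
      (164550, 95003, false), (-95350, -95003, false), (95350, 95003, false),
      (-164550, -95003, false), (-129950, -35074, false)]⟩,
    ⟨7, 34600, 35124, 261821, 0, 129866, 227343, ![(0, 0, true), (-165466, -96039, false),
      (95217, 95878, false), (-95217, -95878, false), (165466, 96039, false),
      (130481, 35122, false), (-130481, -35122, false)]⟩,
    ⟨5, 35124, 35434, 258674, 0, 0, 200001, ![(0, 0, true), (-91337, 100000, false),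
      (129337, -40181, false), (91337, 100000, false), (129337, 40181, false)]⟩,
    ⟨5, 35434, 35874, 200001, 0, 0, 260190, ![(0, 0, true), (100001, -91988, false),
      (-39208, 130095, false), (39208, 130095, false), (100000, 91988, false)]⟩,
    ⟨5, 35874, 36515, 200002, 0, 0, 262364, ![(0, 0, true), (37788, 131182, false),
      (100001, -92933, false), (-37788, 131182, false), (100001, 92933, false)]⟩,
    ⟨5, 36515, 37161, 201146, 0, 0, 264064, ![(0, 0, true), (100573, 93266, false),
      (37161, 132032, false), (100573, -93266, false), (-37161, 132032, false)]⟩,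
    ⟨5, 37161, 37599, 264726, 0, 0, 203136, ![(0, 0, true), (92831, 101568, false),
      (132363, 37599, false), (132363, -37599, false), (-92831, 101568, false)]⟩,
    ⟨5, 37599, 37900, 204498, 0, 0, 265180, ![(0, 0, true), (102249, -92529, false),
      (-37900, 132590, false), (37900, 132590, false), (102249, 92529, false)]⟩,
    ⟨9, 37782, 38069, 344730, 0, -167352, 301383, ![(0, 0, true), (-172365, 101444, true),
      (134134, -32732, false), (38231, 134176, false), (-37895, 132768, false),
      (-98746, -98561, false), (169858, -99969, false), (93733, -101378, false),
      (-134470, -31323, false)]⟩,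
    ⟨9, 38069, 38804, 347244, 0, 173622, 300722, ![(0, 0, true), (173622, 100241, true),
      (96013, -100241, false), (134818, -33030, false), (-96013, -100241, false),
      (-173622, -100241, false), (-38804, 133270, false), (38804, 133270, false),
      (-134818, -33030, false)]⟩,
    ⟨9, 38804, 39332, 349514, 0, 174757, 302688, ![(0, 0, true), (174757, 100896, true),
      (39332, 133666, false), (-174757, -100896, false), (135425, -32770, false),
      (-135425, -32770, false), (-39332, 133666, false), (-96092, -100896, false),
      (96092, -100896, false)]⟩,
    ⟨2, 39332, 41218, 200000, 0, 0, 200000, ![(0, 0, true), (100000, 100000, false)]⟩,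
    ⟨4, 41218, 42354, 400001, 0, 0, 202630, ![(0, 0, true), (200001, 0, true),
      (100000, 101315, false), (-100000, 101315, false)]⟩,
    ⟨4, 42354, 42940, 400002, 0, 0, 204274, ![(0, 0, true), (200001, 0, true),
      (100001, 102137, false), (-100001, 102137, false)]⟩,
    ⟨4, 42940, 43250, 400000, 0, 0, 205140, ![(0, 0, true), (200000, 0, true),
      (100000, 102570, false), (-100000, 102570, false)]⟩ ]

/-- Cells of periodic packings for small radii between `0.51900` and `0.55030`. -/
def cellsB : List (Σ N, Cell N) :=
  [ ⟨3, 51837, 51933, 283353, 0, 68363, 187954, ![(0, 0, true), (-141676, -54879, false),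
      (141676, 54879, false)]⟩,
    ⟨3, 51933, 52078, 283788, 0, -68489, 187909, ![(0, 0, true), (141894, -54718, false),
      (-141894, 54718, false)]⟩,
    ⟨3, 52078, 52300, 200000, 0, 97681, 267154, ![(0, 0, true), (-100000, -114871, false),
      (100000, 114871, false)]⟩,
    ⟨3, 52278, 52606, 285366, 0, 68944, 187742, ![(0, 0, true), (142683, 54133, false),
      (-142683, -54133, false)]⟩,
    ⟨3, 52606, 53117, 200000, 0, 99521, 269069, ![(0, 0, true), (-100000, -115952, false),
      (100000, 115952, false)]⟩,
    ⟨3, 53117, 53582, 200862, 0, 100431, 269777, ![(0, 0, true), (-100431, -116195, false),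
      (100431, 116195, false)]⟩,
    ⟨3, 53582, 53897, 288302, 0, -70721, 189147, ![(0, 0, true), (-144151, 53897, false),
      (144151, -53897, false)]⟩,
    ⟨6, 53897, 54514, 393520, 0, 196760, 340798, ![(0, 0, true), (-196760, -35865, true),
      (129440, 152467, true), (-119501, 97952, false), (-25079, 152467, false),
      (77259, -133817, false)]⟩,
    ⟨6, 54514, 54813, 394538, 0, -197269, 341680, ![(0, 0, true), (-196718, 36091, true),
      (264923, -152317, true), (120039, -97765, false), (-77032, 134288, false),
      (25199, -152749, false)]⟩,
    ⟨6, 54813, 54959, 395036, 0, 197518, 342111, ![(0, 0, true), (-130522, -153665, true),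
      (196697, 36203, true), (119776, -98317, false), (24436, -153021, false),
      (-78037, 133876, false)]⟩,
    ⟨6, 54959, 55030, 395278, 0, -197639, 342321, ![(0, 0, true), (130695, -153856, true),
      (-196687, 36257, true), (-24334, -153109, false), (78162, 133885, false),
      (-119820, -98376, false)]⟩ ]

/-- Cells of periodic packings for small radii between `0.62950` and `0.64350`. -/
def cellsC : List (Σ N, Cell N) :=
  [ ⟨4, 62916, 63050, 315938, 0, -78259, 306092, ![(0, 0, true), (-157969, 122662, true),
      (78259, -143042, false), (157969, -40388, false)]⟩,
    ⟨4, 63050, 63296, 316225, 0, -79047, 306186, ![(0, 0, true), (-158112, 122477, true),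
      (79047, -142889, false), (158112, -40819, false)]⟩,
    ⟨4, 63296, 63753, 316754, 0, -80503, 306353, ![(0, 0, true), (158377, -122136, true),
      (-158377, 41618, false), (-80503, 142599, false)]⟩,
    ⟨4, 63753, 64044, 317306, 0, 79877, 307088, ![(0, 0, true), (158224, 122333, true),
      (-158653, -41711, false), (-80306, -143044, false)]⟩,
    ⟨4, 64044, 64230, 318018, 0, 82200, 307211, ![(0, 0, true), (160420, 123140, true),
      (-159009, -41085, false), (-80789, -142986, false)]⟩,
    ⟨4, 64230, 64350, 318335, 0, 82627, 307425, ![(0, 0, true), (-160935, -123392, true),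
      (80859, 143084, false), (159167, 40949, false)]⟩ ]

set_option maxRecDepth 100000 in
lemma cellsA_valid : ∀ C ∈ cellsA, C.2.Valid := by decide +kernel

lemma cellsB_valid : ∀ C ∈ cellsB, C.2.Valid := by decide +kernel

lemma cellsC_valid : ∀ C ∈ cellsC, C.2.Valid := by decide +kernel

lemma hexDensity_lt_maxDensity_of_mem_cellsA {r : ℝ} (h1 : 0.15 ≤ r) (h2 : r < 0.4325) :
    hexDensity < maxDensity r :=
  Cell.Covers.hexDensity_lt cellsA_valid (a := 15000) (b := 43250) (by decide +kernel)
    (by linarith) (by norm_num; linarith) (by norm_num; linarith)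

lemma hexDensity_lt_maxDensity_of_mem_cellsB {r : ℝ} (h1 : 0.519 ≤ r) (h2 : r < 0.5503) :
    hexDensity < maxDensity r :=
  Cell.Covers.hexDensity_lt cellsB_valid (a := 51900) (b := 55030) (by decide +kernel)
    (by linarith) (by norm_num; linarith) (by norm_num; linarith)

lemma hexDensity_lt_maxDensity_of_mem_cellsC {r : ℝ} (h1 : 0.6295 ≤ r) (h2 : r < 0.6435) :
    hexDensity < maxDensity r :=
  Cell.Covers.hexDensity_lt cellsC_valid (a := 62950) (b := 64350) (by decide +kernel)
    (by linarith) (by norm_num; linarith) (by norm_num; linarith)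

/-! ### Small discs in the holes of the hexagonal packing -/

/-- The cell of the hexagonal packing of the large discs, with a small disc in both holes. -/
def hexCell : Cell 3 :=
  ⟨0, 15400, 200000, 0, 100000, 173205, ![(0, 0, true), (100000, 57735, false),
    (200000, 115470, false)]⟩

/-- The contacts between the discs of `hexCell`. -/
def hexContacts : List (Fin 3 × Fin 3 × ℤ × ℤ) :=
  [(0, 0, 1, 0), (0, 0, -1, 0), (0, 0, 0, 1), (0, 0, 0, -1), (0, 0, -1, 1), (0, 0, 1, -1)]

lemma hexCell_stable : hexCell.Stable 1 hexContacts := by decide +kernel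

lemma hexDensity_lt_maxDensity_of_le {r : ℝ} (h0 : 0 < r) (h1 : r ≤ 0.154) :
    hexDensity < maxDensity r := by
  have hsq : √3 ^ 2 = 3 := Real.sq_sqrt (by norm_num)
  have hl : (1.73205 : ℝ) ≤ √3 := Real.le_sqrt_of_sq_le (by norm_num)
  have hu : √3 ≤ (1.73206 : ℝ) := Real.sqrt_le_iff.2 (by norm_num)
  refine hexCell_stable.hexDensity_lt_maxDensity (u₁ := 2) (u₂ := 0) (v₁ := 1) (v₂ := √3)
    (x := ![0, 1, 2]) (y := ![0, √3 / 3, 2 * √3 / 3])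
    ⟨?_, ?_, ?_, ?_, ?_, ?_⟩ h0 ?_ ?_ ?_ ?_
  · norm_num [hexCell]
  · norm_num [hexCell]
  · norm_num [hexCell]
  · norm_num [hexCell, abs_le]
    constructor <;> linarith
  · intro i
    fin_cases i <;> norm_num [hexCell, Cell.x]
  · intro i
    fin_cases i <;> norm_num [hexCell, Cell.y, abs_le] <;> constructor <;> linarith
  · norm_num [hexCell]
    linarith
  · norm_num [hexContacts, Cell.ρ, Cell.large, hexCell, hsq]
  · simp
  · norm_num [hexCell, Fin.sum_univ_three, Cell.ρ, Cell.large]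
    nlinarith

/-! ### Bounds for products, roots and quotients -/

lemma mul_bounds {a b al au bl bu : ℝ} (ha : al ≤ a ∧ a ≤ au) (hb : bl ≤ b ∧ b ≤ bu)
    (hal : 0 ≤ al) (hbl : 0 ≤ bl) : al * bl ≤ a * b ∧ a * b ≤ au * bu :=
  ⟨mul_le_mul ha.1 hb.1 hbl (hal.trans ha.1),
    mul_le_mul ha.2 hb.2 (hbl.trans hb.1) ((hal.trans ha.1).trans ha.2)⟩

lemma sqrt_bounds {a l u : ℝ} (hu : 0 ≤ u) (h1 : l ^ 2 ≤ a) (h2 : a ≤ u ^ 2) :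
    l ≤ √a ∧ √a ≤ u :=
  ⟨Real.le_sqrt_of_sq_le h1, Real.sqrt_le_iff.2 ⟨hu, h2⟩⟩

lemma div_bounds {a b al au bl bu : ℝ} (ha : al ≤ a ∧ a ≤ au) (hb : bl ≤ b ∧ b ≤ bu)
    (hal : 0 ≤ al) (hbl : 0 < bl) : al / bu ≤ a / b ∧ a / b ≤ au / bl :=
  ⟨div_le_div₀ (hal.trans ha.1) ha.1 (hbl.trans_le hb.1) hb.2,
    div_le_div₀ (hal.trans (ha.1.trans ha.2)) ha.2 hbl hb.1⟩

/-! ### Trapezoids around the small discs -/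

/-- The contacts between two large discs `0`, `1` and two small discs `2`, `3` if the plane is tiled
by isosceles trapezoids of large discs, each around a small disc touching all four of them. -/
def trapezoidContacts : List (Fin 4 × Fin 4 × ℤ × ℤ) :=
  [(0, 1, 0, 0), (0, 1, 1, -1), (0, 1, 1, -2), (0, 2, 0, 0), (0, 2, 0, -1), (0, 3, 0, 0),
    (0, 3, 1, -1), (1, 2, 0, 0), (1, 2, -1, 1), (1, 3, 0, 0), (1, 3, 0, 1)]

/-- The short base of a trapezoid and its legs have length `2`. Its height is `w q` and its long base
`2 (3 - q)`, where `w² = (1 + r)² - 1` and `q = 4 / (1 + r)²`. -/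
lemma hexDensity_lt_maxDensity_of_trapezoid {C : Cell 4} {E : ℕ}
    (hC : C.Stable E trapezoidContacts) (hlarge : C.large = ![true, true, false, false])
    {r w q : ℝ} (hr : 0 < r) (hr' : r ≤ (C.hi : ℝ) / 100000) (hw0 : 0 < w)
    (hw : w ^ 2 = (1 + r) ^ 2 - 1) (hq : q * (1 + r) ^ 2 = 4)
    (happ : C.Approx E (100000 * (2 * (4 - q))) (100000 * 0) (100000 * (4 - q)) (100000 * (w * q))
      (fun i => 100000 * (![1, 3 - q, 0, 4 - q] : Fin 4 → ℝ) i)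
      (fun i => 100000 * (![w, w - w * q, 0, 2 * w - w * q] : Fin 4 → ℝ) i))
    (hP : 64 * r ^ 3 * (r + 2) ^ 3 < 3 * (r ^ 2 + 1) ^ 2 * (r + 1) ^ 8) :
    hexDensity < maxDensity r := by
  have hR : (1 : ℝ) < (1 + r) ^ 2 := by nlinarith
  have hq0 : 0 < q := pos_of_mul_pos_left (by rw [hq]; norm_num) (by positivity)
  have hq4 : 0 < 4 - q := by nlinarith
  refine hC.hexDensity_lt_maxDensity happ hr hr' ?_ (by nlinarith [mul_pos hw0 hq0]) ?_
  · have h1 : w ^ 2 * q = 4 - q := by rw [hw]; linear_combination hq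
    have h2 : (1 - (3 - q)) ^ 2 + (w * q) ^ 2 = 4 := by linear_combination q * h1
    have h3 : 1 + w ^ 2 = (1 + r) ^ 2 := by rw [hw]; ring
    have h4 : (3 - q) ^ 2 + (w - w * q) ^ 2 = (1 + r) ^ 2 := by
      linear_combination (q - 2) * h1 + hw
    simp only [trapezoidContacts, List.forall_mem_cons, Cell.ρ, hlarge]
    simp
    constructorm* _ ∧ _ <;> linarith
  · have hsq : √3 ^ 2 = 3 := Real.sq_sqrt (by norm_num)
    have h1 : 8 * w ^ 3 < √3 * (1 + r ^ 2) * (1 + r) ^ 4 := by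
      refine lt_of_pow_lt_pow_left₀ 2 (by positivity) ?_
      have h2 : (8 * w ^ 3) ^ 2 = 64 * r ^ 3 * (r + 2) ^ 3 := by
        rw [show (8 * w ^ 3) ^ 2 = 64 * (w ^ 2) ^ 3 by ring, hw]
        ring
      rw [h2, mul_pow, mul_pow, hsq]
      linarith
    have h2 : (4 - q) * (w * q) * (1 + r) ^ 4 = 16 * w ^ 3 := by
      have h3 : (4 - q) * (1 + r) ^ 2 = 4 * w ^ 2 := by rw [hw]; linear_combination -hq
      linear_combination w * q * (1 + r) ^ 2 * h3 + 4 * w ^ 3 * hq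
    have h3 : (4 - q) * (w * q) < 2 * √3 * (1 + r ^ 2) := by
      refine lt_of_mul_lt_mul_right ?_ (show 0 ≤ (1 + r) ^ 4 by positivity)
      rw [h2]
      linarith
    simp [Fin.sum_univ_four, Cell.ρ, hlarge]
    linarith

lemma trapezoid_bounds {r lo hi wl wu ql qu : ℝ} (h0 : 0 < lo) (hr1 : lo ≤ r) (hr2 : r ≤ hi)
    (hwu : 0 ≤ wu) (h1 : wl ^ 2 ≤ (1 + lo) ^ 2 - 1) (h2 : (1 + hi) ^ 2 - 1 ≤ wu ^ 2)
    (h3 : ql * (1 + hi) ^ 2 ≤ 4) (h4 : 4 ≤ qu * (1 + lo) ^ 2) :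
    (wl ≤ √((1 + r) ^ 2 - 1) ∧ √((1 + r) ^ 2 - 1) ≤ wu) ∧
    (ql ≤ 4 / (1 + r) ^ 2 ∧ 4 / (1 + r) ^ 2 ≤ qu) := by
  have h5 : (1 + lo) ^ 2 ≤ (1 + r) ^ 2 := by gcongr
  have h6 : (1 + r) ^ 2 ≤ (1 + hi) ^ 2 := pow_le_pow_left₀ (by linarith) (by linarith) 2
  have h7 : 0 < (1 + lo) ^ 2 := by positivity
  refine ⟨sqrt_bounds hwu (by linarith) (by linarith), ?_, ?_⟩
  · refine le_trans ?_ (div_le_div_of_nonneg_left (by norm_num) (by linarith) h6)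
    rwa [le_div_iff₀ (by linarith)]
  · refine le_trans (div_le_div_of_nonneg_left (by norm_num) h7 h5) ?_
    rwa [div_le_iff₀ h7]

/-- The cell of the trapezoids for small radii close to `0.435`. -/
def trapezoidCell₁ : Cell 4 :=
  ⟨43200, 43800, 411504, 0, 205752, 199917, ![(100000, 102919, true), (105752, -96999, true),
    (0, 0, false), (205752, 5920, false)]⟩

lemma trapezoidCell₁_stable : trapezoidCell₁.Stable 2600 trapezoidContacts := by decide +kernel

lemma hexDensity_lt_maxDensity_of_trapezoid₁ {r : ℝ} (h1 : 0.432 ≤ r) (h2 : r ≤ 0.438)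
    (hP : 64 * r ^ 3 * (r + 2) ^ 3 < 3 * (r ^ 2 + 1) ^ 2 * (r + 1) ^ 8) :
    hexDensity < maxDensity r := by
  obtain ⟨hw, hq⟩ := trapezoid_bounds (wl := 1.0249) (wu := 1.0334) (ql := 1.9343) (qu := 1.9507)
    (by norm_num) h1 h2 (by norm_num) (by norm_num) (by norm_num) (by norm_num) (by norm_num)
  have hwq := mul_bounds hw hq (by norm_num) (by norm_num)
  have h0 : (0 : ℝ) ≤ (1 + r) ^ 2 - 1 := by nlinarith
  have hsq := Real.sq_sqrt h0
  have hq4 : 4 / (1 + r) ^ 2 * (1 + r) ^ 2 = 4 := div_mul_cancel₀ _ (by positivity)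
  generalize √((1 + r) ^ 2 - 1) = w at *
  generalize 4 / (1 + r) ^ 2 = q at *
  refine hexDensity_lt_maxDensity_of_trapezoid trapezoidCell₁_stable ?_ (by linarith)
    ?_ (by linarith) hsq hq4 ⟨?_, ?_, ?_, ?_, ?_, ?_⟩ hP
  · ext i; fin_cases i <;> rfl
  · norm_num [trapezoidCell₁]; linarith
  · norm_num [trapezoidCell₁, abs_le]; constructor <;> linarith
  · norm_num [trapezoidCell₁]
  · norm_num [trapezoidCell₁, abs_le]; constructor <;> linarith
  · norm_num [trapezoidCell₁, abs_le]; constructor <;> linarith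
  · intro i
    fin_cases i <;> norm_num [trapezoidCell₁, Cell.x, abs_le] <;> constructor <;> linarith
  · intro i
    fin_cases i <;> norm_num [trapezoidCell₁, Cell.y, abs_le] <;> constructor <;> linarith

/-- The cell of the trapezoids for small radii close to `0.6287`. -/
def trapezoidCell₂ : Cell 4 :=
  ⟨62740, 63000, 498416, 0, 249208, 193852, ![(100000, 128556, true), (149208, -65296, true),
    (0, 0, false), (249208, 63260, false)]⟩

lemma trapezoidCell₂_stable : trapezoidCell₂.Stable 1400 trapezoidContacts := by decide +kernel

lemma hexDensity_lt_maxDensity_of_trapezoid₂ {r : ℝ} (h1 : 0.6274 ≤ r) (h2 : r ≤ 0.63)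
    (hP : 64 * r ^ 3 * (r + 2) ^ 3 < 3 * (r ^ 2 + 1) ^ 2 * (r + 1) ^ 8) :
    hexDensity < maxDensity r := by
  obtain ⟨hw, hq⟩ := trapezoid_bounds (wl := 1.2839) (wu := 1.2873) (ql := 1.5055) (qu := 1.5104)
    (by norm_num) h1 h2 (by norm_num) (by norm_num) (by norm_num) (by norm_num) (by norm_num)
  have hwq := mul_bounds hw hq (by norm_num) (by norm_num)
  have h0 : (0 : ℝ) ≤ (1 + r) ^ 2 - 1 := by nlinarith
  have hsq := Real.sq_sqrt h0
  have hq4 : 4 / (1 + r) ^ 2 * (1 + r) ^ 2 = 4 := div_mul_cancel₀ _ (by positivity)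
  generalize √((1 + r) ^ 2 - 1) = w at *
  generalize 4 / (1 + r) ^ 2 = q at *
  refine hexDensity_lt_maxDensity_of_trapezoid trapezoidCell₂_stable ?_ (by linarith)
    ?_ (by linarith) hsq hq4 ⟨?_, ?_, ?_, ?_, ?_, ?_⟩ hP
  · ext i; fin_cases i <;> rfl
  · norm_num [trapezoidCell₂]; linarith
  · norm_num [trapezoidCell₂, abs_le]; constructor <;> linarith
  · norm_num [trapezoidCell₂]
  · norm_num [trapezoidCell₂, abs_le]; constructor <;> linarith
  · norm_num [trapezoidCell₂, abs_le]; constructor <;> linarith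
  · intro i
    fin_cases i <;> norm_num [trapezoidCell₂, Cell.x, abs_le] <;> constructor <;> linarith
  · intro i
    fin_cases i <;> norm_num [trapezoidCell₂, Cell.y, abs_le] <;> constructor <;> linarith

/-! ### Lattices with two small discs in a cell -/

/-- The contacts between a large disc `0` and two small discs `1`, `2` if each small disc touches three
large discs, two of which touch each other, and one small disc. -/
def rowContacts : List (Fin 3 × Fin 3 × ℤ × ℤ) :=
  [(0, 0, 0, 1), (0, 0, 0, -1), (0, 1, 0, 0), (0, 1, 1, 0), (0, 1, 0, 1), (0, 2, 0, 0),
    (0, 2, 1, 0), (0, 2, 1, -1), (1, 2, 0, -1)]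

/-- The cell of the packing with contacts `rowContacts` for small radii close to `0.5177`. -/
def rowCell : Cell 3 :=
  ⟨51630, 51900, 282846, 0, 68217, 188006, ![(0, 0, true), (141423, 55065, false),
    (141423, -55065, false)]⟩

lemma rowCell_stable : rowCell.Stable 2500 rowContacts := by decide +kernel

/-- The norm of `α + β H`, for two polynomials `α` and `β` in `r` and a root `H` of a quadratic
polynomial over `ℚ(r)`. -/
lemma row_norm (r : ℝ) :
    (1 + r) ^ 2 * (-4 - 16 * r - 12 * r ^ 2 + 24 * r ^ 3 + 36 * r ^ 4 - 20 * r ^ 6 - 8 * r ^ 7) ^ 2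
      + (-4 - 16 * r - 12 * r ^ 2 + 24 * r ^ 3 + 36 * r ^ 4 - 20 * r ^ 6 - 8 * r ^ 7)
        * (7 + 20 * r + 6 * r ^ 2 + 12 * r ^ 3 + 91 * r ^ 4 + 104 * r ^ 5 + 84 * r ^ 6
          + 48 * r ^ 7 + 12 * r ^ 8) * (2 * (1 + r) ^ 2 * (1 + r ^ 2) - 4 * r ^ 2)
      + (7 + 20 * r + 6 * r ^ 2 + 12 * r ^ 3 + 91 * r ^ 4 + 104 * r ^ 5 + 84 * r ^ 6
          + 48 * r ^ 7 + 12 * r ^ 8) ^ 2 * ((1 + r) ^ 2 * (1 - r ^ 2) ^ 2)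
      = (1 + r) ^ 8 * (1 - r) ^ 2 * (144 * r ^ 12 + 576 * r ^ 11 + 1152 * r ^ 10
        + 1728 * r ^ 9 + 1704 * r ^ 8 + 672 * r ^ 7 + 312 * r ^ 6 - 384 * r ^ 5 - 143 * r ^ 4
        + 52 * r ^ 3 - 50 * r ^ 2 - 12 * r + 9) := by
  ring

/-- The area of the cell is `2 e t`. Its comparison with the hexagonal packing is a condition on `h²`,
which is a root of a quadratic polynomial over `ℚ(r)`. The product of the condition for both roots
is, up to squares, the polynomial `poly₂`. -/
lemma row_area_lt {r H h e t : ℝ} (h1 : 0.5163 ≤ r) (h2 : r ≤ 0.519)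
    (hQ : (1 + r) ^ 2 * H ^ 2 - (2 * (1 + r) ^ 2 * (1 + r ^ 2) - 4 * r ^ 2) * H
      + (1 + r) ^ 2 * (1 - r ^ 2) ^ 2 = 0) (hH : H ≤ 0.31)
    (hh : h ^ 2 = H) (he : e ^ 2 = (1 + r) ^ 2 - H) (ht : t * h = 1 - r ^ 2 + H)
    (hP : 0 < 144 * r ^ 12 + 576 * r ^ 11 + 1152 * r ^ 10 + 1728 * r ^ 9 + 1704 * r ^ 8
      + 672 * r ^ 7 + 312 * r ^ 6 - 384 * r ^ 5 - 143 * r ^ 4 + 52 * r ^ 3 - 50 * r ^ 2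
      - 12 * r + 9) : e * t < √3 * (1 + 2 * r ^ 2) := by
  have hr : 0 < r := by linarith
  -- Modulo the quadratic equation of `H`, the condition to be shown becomes `0 < α + β * H`.
  obtain ⟨α, hα⟩ : ∃ α, α = -4 - 16 * r - 12 * r ^ 2 + 24 * r ^ 3 + 36 * r ^ 4 - 20 * r ^ 6
      - 8 * r ^ 7 := ⟨_, rfl⟩
  obtain ⟨β, hβ⟩ : ∃ β, β = 7 + 20 * r + 6 * r ^ 2 + 12 * r ^ 3 + 91 * r ^ 4 + 104 * r ^ 5
      + 84 * r ^ 6 + 48 * r ^ 7 + 12 * r ^ 8 := ⟨_, rfl⟩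
  -- The conjugate of `α + β * H`, multiplied by `(1 + r) ^ 2`, is positive.
  have hconj : 0 < (1 + r) ^ 2 * α + β * (2 * (1 + r) ^ 2 * (1 + r ^ 2) - 4 * r ^ 2)
      - (1 + r) ^ 2 * β * H := by
    have hα' : -17 ≤ α := by
      have h3 : r ^ 6 ≤ 0.52 ^ 6 := pow_le_pow_left₀ hr.le (by linarith) 6
      have h4 : r ^ 7 ≤ 0.52 ^ 7 := pow_le_pow_left₀ hr.le (by linarith) 7
      have : 0 ≤ r ^ 3 := by positivity
      have : 0 ≤ r ^ 4 := by positivity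
      norm_num at h3 h4
      nlinarith
    have hβ' : 17 ≤ β := by
      have : 0 ≤ 6 * r ^ 2 + 12 * r ^ 3 + 91 * r ^ 4 + 104 * r ^ 5 + 84 * r ^ 6
        + 48 * r ^ 7 + 12 * r ^ 8 := by positivity
      linarith
    have h3 : 1 * (1 + r) ^ 2 ≤ 2 * (1 + r) ^ 2 * (1 + r ^ 2) - 4 * r ^ 2 - (1 + r) ^ 2 * H
        - (1 + r) ^ 2 * 0.2 := by
      have : (1 + r) ^ 2 * H ≤ (1 + r) ^ 2 * 0.31 := by gcongr
      nlinarith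
    have h4 : 0 < (1 + r) ^ 2 := by positivity
    nlinarith [mul_le_mul_of_nonneg_right h3 (by linarith : 0 ≤ β),
      mul_le_mul_of_nonneg_right hα' h4.le, mul_le_mul_of_nonneg_right hβ' h4.le]
  have hprod : (α + β * H) * ((1 + r) ^ 2 * α
      + β * (2 * (1 + r) ^ 2 * (1 + r ^ 2) - 4 * r ^ 2) - (1 + r) ^ 2 * β * H)
      = (1 + r) ^ 8 * (1 - r) ^ 2 * (144 * r ^ 12 + 576 * r ^ 11 + 1152 * r ^ 10
      + 1728 * r ^ 9 + 1704 * r ^ 8 + 672 * r ^ 7 + 312 * r ^ 6 - 384 * r ^ 5 - 143 * r ^ 4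
      + 52 * r ^ 3 - 50 * r ^ 2 - 12 * r + 9) := by
    rw [← row_norm, ← hα, ← hβ]
    linear_combination (-β ^ 2) * hQ
  have hpos : 0 < α + β * H := by
    refine pos_of_mul_pos_left ?_ hconj.le
    rw [hprod]
    have : 0 < (1 - r) ^ 2 := by nlinarith
    positivity
  have hg : ((1 + r) ^ 2 - H) * (1 - r ^ 2 + H) ^ 2 < 3 * (1 + 2 * r ^ 2) ^ 2 * H := by
    have h3 : (1 + r) ^ 4 * (3 * (1 + 2 * r ^ 2) ^ 2 * H
        - ((1 + r) ^ 2 - H) * (1 - r ^ 2 + H) ^ 2) = α + β * H := by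
      rw [hα, hβ]
      linear_combination ((1 + r) ^ 2 * H + (2 * (1 + r) ^ 2 * (1 + r ^ 2) - 4 * r ^ 2)
        + (2 * (1 - r ^ 2) - (1 + r) ^ 2) * (1 + r) ^ 2) * hQ
    have := pos_of_mul_pos_right (h3 ▸ hpos) (by positivity)
    linarith
  refine lt_of_pow_lt_pow_left₀ 2 (by positivity) ?_
  refine lt_of_mul_lt_mul_right ?_ (sq_nonneg h)
  have hsq : √3 ^ 2 = 3 := Real.sq_sqrt (by norm_num)
  calc (e * t) ^ 2 * h ^ 2 = e ^ 2 * (t * h) ^ 2 := by ring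
    _ = ((1 + r) ^ 2 - H) * (1 - r ^ 2 + H) ^ 2 := by rw [he, ht]
    _ < 3 * (1 + 2 * r ^ 2) ^ 2 * H := hg
    _ = (√3 * (1 + 2 * r ^ 2)) ^ 2 * h ^ 2 := by rw [mul_pow, hsq, hh]

/-- The coordinates of the packing with contacts `rowContacts`: the lattice is spanned by `(2 e, 0)`
and `(p, t)`, and the small discs are at `(e, ±h)` if a large one is at the origin. -/
lemma exists_row {r : ℝ} (h1 : 0.5163 ≤ r) (h2 : r ≤ 0.519) :
    ∃ e h p t : ℝ, (1.4103 ≤ e ∧ e ≤ 1.4182) ∧ (0.5444 ≤ h ∧ h ≤ 0.5568) ∧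
      (0.67448 ≤ p ∧ p ≤ 0.68986) ∧ (1.8565 ≤ t ∧ t ≤ 1.9041) ∧ h ^ 2 ≤ 0.31 ∧
      e ^ 2 = (1 + r) ^ 2 - h ^ 2 ∧ t * h = 1 - r ^ 2 + h ^ 2 ∧ p * e = 1 + r ^ 2 - h ^ 2 ∧
      (1 + r) ^ 2 * (h ^ 2) ^ 2 - (2 * (1 + r) ^ 2 * (1 + r ^ 2) - 4 * r ^ 2) * h ^ 2
        + (1 + r) ^ 2 * (1 - r ^ 2) ^ 2 = 0 := by
  have hr : 0 < r := by linarith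
  obtain ⟨hr2, hr2'⟩ : (0.26656 : ℝ) ≤ r ^ 2 ∧ r ^ 2 ≤ 0.26937 :=
    ⟨by nlinarith, by nlinarith⟩
  obtain ⟨κ, hκ⟩ : ∃ κ, κ = 4 * r ^ 2 / (1 + r) ^ 2 := ⟨_, rfl⟩
  have hκR : κ * (1 + r) ^ 2 = 4 * r ^ 2 := by rw [hκ, div_mul_cancel₀ _ (by positivity)]
  have hκl : 0.46376 ≤ κ := by rw [hκ, le_div_iff₀ (by positivity)]; nlinarith
  have hκu : κ ≤ 0.46697 := by rw [hκ, div_le_iff₀ (by positivity)]; nlinarith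
  obtain ⟨d, hd⟩ : ∃ d, d = √((4 - κ) * (4 * r ^ 2 - κ)) := ⟨_, rfl⟩
  have hDb := mul_bounds (a := 4 - κ) (b := 4 * r ^ 2 - κ) (al := 3.53303) (au := 3.53624)
    (bl := 0.59927) (bu := 0.61372) ⟨by linarith, by linarith⟩ ⟨by linarith, by linarith⟩
    (by norm_num) (by norm_num)
  have hdb : 1.4550 ≤ d ∧ d ≤ 1.4732 := by
    rw [hd]
    exact sqrt_bounds (by norm_num) (by linarith) (by linarith)
  have hd2 : d ^ 2 = (4 - κ) * (4 * r ^ 2 - κ) := by rw [hd, Real.sq_sqrt (by linarith)]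
  obtain ⟨H, hH⟩ : ∃ H, H = (2 * (1 + r ^ 2) - κ - d) / 2 := ⟨_, rfl⟩
  have hHl : 0.29647 ≤ H := by linarith
  have hHu : H ≤ 0.31 := by linarith
  have hQ : (1 + r) ^ 2 * H ^ 2 - (2 * (1 + r) ^ 2 * (1 + r ^ 2) - 4 * r ^ 2) * H
      + (1 + r) ^ 2 * (1 - r ^ 2) ^ 2 = 0 := by
    have h3 : H ^ 2 - (2 * (1 + r ^ 2) - κ) * H + (1 - r ^ 2) ^ 2 = 0 := by
      rw [hH]
      linear_combination hd2 / 4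
    linear_combination (1 + r) ^ 2 * h3 - H * hκR
  obtain ⟨h, hh⟩ : ∃ h, h = √H := ⟨_, rfl⟩
  have hhb : 0.5444 ≤ h ∧ h ≤ 0.5568 := by
    rw [hh]
    exact sqrt_bounds (by norm_num) (by linarith) (by linarith)
  have hh2 : h ^ 2 = H := by rw [hh, Real.sq_sqrt (by linarith)]
  obtain ⟨e, he⟩ : ∃ e, e = √((1 + r) ^ 2 - H) := ⟨_, rfl⟩
  have heb : 1.4103 ≤ e ∧ e ≤ 1.4182 := by
    rw [he]
    exact sqrt_bounds (by norm_num) (by nlinarith) (by nlinarith)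
  have he2 : e ^ 2 = (1 + r) ^ 2 - H := by rw [he, Real.sq_sqrt (by nlinarith)]
  have hh0 : 0 < h := by linarith
  have he0 : 0 < e := by linarith
  have hsb := div_bounds (a := 1 - r ^ 2) (b := h) (al := 0.73063) (au := 0.73344)
    ⟨by linarith, by linarith⟩ hhb (by norm_num) (by norm_num)
  have hpb := div_bounds (a := 1 + r ^ 2 - H) (b := e) (al := 0.95656) (au := 0.9729)
    ⟨by linarith, by linarith⟩ heb (by norm_num) (by norm_num)
  obtain ⟨t, ht⟩ : ∃ t, t = (1 - r ^ 2) / h + h := ⟨_, rfl⟩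
  obtain ⟨p, hp⟩ : ∃ p, p = (1 + r ^ 2 - H) / e := ⟨_, rfl⟩
  have hth : t * h = 1 - r ^ 2 + H := by
    rw [ht, add_mul, div_mul_cancel₀ _ hh0.ne', ← hh2]
    ring
  have hpe : p * e = 1 + r ^ 2 - H := by rw [hp, div_mul_cancel₀ _ he0.ne']
  rw [← hp] at hpb
  have htb : 1.8565 ≤ t ∧ t ≤ 1.9041 := by
    rw [ht]
    norm_num at hsb
    constructor <;> linarith
  norm_num at hpb
  refine ⟨e, h, p, t, heb, hhb, ⟨?_, ?_⟩, htb, ?_, ?_, hth.trans ?_, hpe.trans ?_, ?_⟩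
  · linarith [hpb.1]
  · linarith [hpb.2]
  all_goals rw [hh2]
  · exact hHu
  · exact he2
  · exact hQ

lemma hexDensity_lt_maxDensity_of_row {r : ℝ} (h1 : 0.5163 ≤ r) (h2 : r ≤ 0.519)
    (hP : 0 < 144 * r ^ 12 + 576 * r ^ 11 + 1152 * r ^ 10 + 1728 * r ^ 9 + 1704 * r ^ 8
      + 672 * r ^ 7 + 312 * r ^ 6 - 384 * r ^ 5 - 143 * r ^ 4 + 52 * r ^ 3 - 50 * r ^ 2
      - 12 * r + 9) : hexDensity < maxDensity r := by
  obtain ⟨e, h, p, t, heb, hhb, hpb, htb, hhu, he, hth, hpe, hQ⟩ := exists_row h1 h2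
  have he0 : 0 < e := by linarith
  have hh0 : 0 < h := by linarith
  have harea := row_area_lt h1 h2 hQ hhu rfl he hth hP
  clear hP
  have hv : p ^ 2 + t ^ 2 = 4 := by
    refine mul_right_cancel₀ (mul_ne_zero (pow_ne_zero 2 he0.ne') (pow_ne_zero 2 hh0.ne')) ?_
    have h3 : (p ^ 2 + t ^ 2) * (e ^ 2 * h ^ 2) = (p * e) ^ 2 * h ^ 2 + (t * h) ^ 2 * e ^ 2 := by
      ring
    rw [h3, hpe, hth, he]
    linear_combination hQ
  clear hQ
  have hlarge : rowCell.large = ![true, false, false] := by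
    ext i
    fin_cases i <;> rfl
  refine rowCell_stable.hexDensity_lt_maxDensity (u₁ := 2 * e) (u₂ := 0) (v₁ := p) (v₂ := t)
    (x := ![0, e, e]) (y := ![0, h, -h]) ⟨?_, ?_, ?_, ?_, ?_, ?_⟩ (by linarith) ?_ ?_ ?_ ?_
  · norm_num [rowCell, abs_le]; constructor <;> linarith
  · norm_num [rowCell]
  · norm_num [rowCell, abs_le]; constructor <;> linarith
  · norm_num [rowCell, abs_le]; constructor <;> linarith
  · intro i
    fin_cases i <;> norm_num [rowCell, Cell.x, abs_le] <;> constructor <;> linarith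
  · intro i
    fin_cases i <;> norm_num [rowCell, Cell.y, abs_le] <;> constructor <;> linarith
  · norm_num [rowCell]; linarith
  · simp only [rowContacts, List.forall_mem_cons]
    simp [Cell.ρ, hlarge]
    constructorm* _ ∧ _ <;> linarith
  · have : 0 < e * t := mul_pos he0 (by linarith)
    linarith
  · simp [Fin.sum_univ_three, Cell.ρ, hlarge]
    linarith

/-! ### Centred rectangular lattices of pairs of small discs -/

/-- The contacts between two large discs `0`, `1` and two small discs `2`, `3` that touch each other,
if a pair of small discs is surrounded by six large ones. -/
def pairContacts : List (Fin 4 × Fin 4 × ℤ × ℤ) :=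
  [(0, 1, 0, 0), (0, 1, 1, 0), (0, 2, 0, 0), (0, 2, 1, -1), (0, 3, 0, 0), (0, 3, 0, -1),
    (1, 2, 0, 0), (1, 2, 0, -1), (1, 3, -1, 0), (1, 3, 0, -1), (2, 3, 0, 0)]

/-- The cell of the packing with contacts `pairContacts` for small radii close to `0.6444`. -/
def pairCell : Cell 4 :=
  ⟨64300, 64580, 387463, 0, 193732, 252896, ![(0, 151288, true), (193732, 101608, true),
    (64440, 0, false), (-64440, 0, false)]⟩

lemma pairCell_stable : pairCell.Stable 650 pairContacts := by decide +kernel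

/-- The norm of `α - β c`, for two polynomials `α` and `β` in `r` and a root `c` of a quadratic
polynomial over `ℚ(r)`. -/
lemma pair_norm (r : ℝ) :
    (1 + r) ^ 2 * (12 + 96 * r + 348 * r ^ 2 + 664 * r ^ 3 + 488 * r ^ 4 + 192 * r ^ 5
        + 968 * r ^ 6 + 1360 * r ^ 7 + 972 * r ^ 8 + 480 * r ^ 9 + 156 * r ^ 10 + 24 * r ^ 11) ^ 2
      - 4 * r * (12 + 96 * r + 348 * r ^ 2 + 664 * r ^ 3 + 488 * r ^ 4 + 192 * r ^ 5
        + 968 * r ^ 6 + 1360 * r ^ 7 + 972 * r ^ 8 + 480 * r ^ 9 + 156 * r ^ 10 + 24 * r ^ 11)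
        * (128 * r ^ 3 + 704 * r ^ 4 + 1216 * r ^ 5 + 704 * r ^ 6 + 128 * r ^ 7)
      - 8 * r * (128 * r ^ 3 + 704 * r ^ 4 + 1216 * r ^ 5 + 704 * r ^ 6 + 128 * r ^ 7) ^ 2
      = -16 * (1 + r) ^ 6 * (1 - r) * (1 + 2 * r) ^ 2 * (9 * r ^ 15 + 81 * r ^ 14 + 369 * r ^ 13
        + 1161 * r ^ 12 + 2757 * r ^ 11 + 4749 * r ^ 10 + 5805 * r ^ 9 + 5445 * r ^ 8
        + 3643 * r ^ 7 + 1235 * r ^ 6 + 243 * r ^ 5 - 1029 * r ^ 4 - 969 * r ^ 3 - 369 * r ^ 2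
        - 81 * r - 9) := by
  ring

/-- The area of the cell is `2 c r (4 + c) / g`. The square of its comparison with the hexagonal
packing is a condition on `c`, which is a root of a quadratic polynomial over `ℚ(r)`. The product of
the condition for both roots is, up to factors of known sign, the polynomial `poly₅`. -/
lemma pair_area_lt {r c g : ℝ} (h1 : 0.643 ≤ r) (h2 : r ≤ 0.6458)
    (hQ : (1 + r) ^ 2 * c ^ 2 - 4 * r * c - 8 * r = 0) (hc : 1 ≤ c)
    (hg0 : 0 < g) (hg : g ^ 2 = 1 + 2 * r)
    (hP : 9 * r ^ 15 + 81 * r ^ 14 + 369 * r ^ 13 + 1161 * r ^ 12 + 2757 * r ^ 11 + 4749 * r ^ 10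
      + 5805 * r ^ 9 + 5445 * r ^ 8 + 3643 * r ^ 7 + 1235 * r ^ 6 + 243 * r ^ 5 - 1029 * r ^ 4
      - 969 * r ^ 3 - 369 * r ^ 2 - 81 * r - 9 < 0) :
    c * r * (4 + c) < 2 * √3 * (1 + r ^ 2) * g := by
  have hr : 0 < r := by linarith
  -- Modulo the quadratic equation of `c`, the condition to be shown becomes `0 < α - β * c`.
  obtain ⟨α, hα⟩ : ∃ α, α = 12 + 96 * r + 348 * r ^ 2 + 664 * r ^ 3 + 488 * r ^ 4 + 192 * r ^ 5
      + 968 * r ^ 6 + 1360 * r ^ 7 + 972 * r ^ 8 + 480 * r ^ 9 + 156 * r ^ 10 + 24 * r ^ 11 :=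
    ⟨_, rfl⟩
  obtain ⟨β, hβ⟩ : ∃ β, β = 128 * r ^ 3 + 704 * r ^ 4 + 1216 * r ^ 5 + 704 * r ^ 6
      + 128 * r ^ 7 := ⟨_, rfl⟩
  have hα0 : 0 < α := by rw [hα]; positivity
  have hβ0 : 0 < β := by rw [hβ]; positivity
  -- The conjugate of `α - β * c`, multiplied by `(1 + r) ^ 2`, is positive.
  have hconj : 0 < (1 + r) ^ 2 * α + β * ((1 + r) ^ 2 * c - 4 * r) := by
    have h3 : 0 < (1 + r) ^ 2 * c - 4 * r := by
      nlinarith [mul_nonneg (sq_nonneg (1 + r)) (sub_nonneg.2 hc), mul_pos hr (sub_pos.2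
        (show r < 1 by linarith)), sq_nonneg (1 - r)]
    positivity
  have hprod : (α - β * c) * ((1 + r) ^ 2 * α + β * ((1 + r) ^ 2 * c - 4 * r))
      = -16 * (1 + r) ^ 6 * (1 - r) * (1 + 2 * r) ^ 2 * (9 * r ^ 15 + 81 * r ^ 14 + 369 * r ^ 13
        + 1161 * r ^ 12 + 2757 * r ^ 11 + 4749 * r ^ 10 + 5805 * r ^ 9 + 5445 * r ^ 8
        + 3643 * r ^ 7 + 1235 * r ^ 6 + 243 * r ^ 5 - 1029 * r ^ 4 - 969 * r ^ 3 - 369 * r ^ 2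
        - 81 * r - 9) := by
    rw [← pair_norm, ← hα, ← hβ]
    linear_combination (-β ^ 2) * hQ
  have hpos : 0 < α - β * c := by
    refine pos_of_mul_pos_left ?_ hconj.le
    rw [hprod]
    have h3 : 0 < 1 - r := by linarith
    have h4 : 0 < 16 * (1 + r) ^ 6 * (1 - r) * (1 + 2 * r) ^ 2 := by positivity
    linarith [mul_neg_of_pos_of_neg h4 hP]
  have hg' : c ^ 2 * r ^ 2 * (4 + c) ^ 2 < 12 * (1 + r ^ 2) ^ 2 * (1 + 2 * r) := by
    have h3 : (1 + r) ^ 6 * (12 * (1 + r ^ 2) ^ 2 * (1 + 2 * r) - c ^ 2 * r ^ 2 * (4 + c) ^ 2)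
        = α - β * c := by
      rw [hα, hβ]
      linear_combination (-r ^ 2) * (16 * (1 + r) ^ 4 + 8 * ((1 + r) ^ 4 * c + 4 * r * (1 + r) ^ 2)
        + (1 + r) ^ 4 * c ^ 2 + 4 * r * (1 + r) ^ 2 * c + 16 * r ^ 2 + 8 * r * (1 + r) ^ 2) * hQ
    have := pos_of_mul_pos_right (h3 ▸ hpos) (by positivity)
    linarith
  refine lt_of_pow_lt_pow_left₀ 2 (by positivity) ?_
  have hsq : √3 ^ 2 = 3 := Real.sq_sqrt (by norm_num)
  calc (c * r * (4 + c)) ^ 2 = c ^ 2 * r ^ 2 * (4 + c) ^ 2 := by ring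
    _ < 12 * (1 + r ^ 2) ^ 2 * (1 + 2 * r) := hg'
    _ = (2 * √3 * (1 + r ^ 2) * g) ^ 2 := by
      rw [mul_pow, mul_pow, mul_pow, hsq, hg]
      ring

/-- The coordinates of the packing with contacts `pairContacts`: the lattice is spanned by `(2 c, 0)`
and `(c, g + k)`, the small discs are at `(±r, 0)`, and the large ones at `(0, g)` and `(c, k)`. -/
lemma exists_pair {r : ℝ} (h1 : 0.643 ≤ r) (h2 : r ≤ 0.6458) :
    ∃ c g k : ℝ, (1.9366 ≤ c ∧ c ≤ 1.9381) ∧ (1.5119 ≤ g ∧ g ≤ 1.5139) ∧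
      (1.0114 ≤ k ∧ k ≤ 1.0209) ∧ (1 + r) ^ 2 * c ^ 2 - 4 * r * c - 8 * r = 0 ∧
      g ^ 2 = 1 + 2 * r ∧ k * g = c * r + 2 * r - 1 := by
  obtain ⟨y, hy⟩ : ∃ y, y = 4 * r / (1 + r) ^ 2 := ⟨_, rfl⟩
  have hyR : y * (1 + r) ^ 2 = 4 * r := by rw [hy, div_mul_cancel₀ _ (by positivity)]
  have hyb : 0.95278 ≤ y ∧ y ≤ 0.95369 := by
    rw [hy, le_div_iff₀ (by positivity), div_le_iff₀ (by positivity)]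
    constructor <;> nlinarith
  have hy2 := mul_bounds hyb hyb (by norm_num) (by norm_num)
  obtain ⟨d, hd⟩ : ∃ d, d = √(y * y + 8 * y) := ⟨_, rfl⟩
  have hdb : 2.9205 ≤ d ∧ d ≤ 2.9223 := by
    rw [hd]
    exact sqrt_bounds (by norm_num) (by linarith) (by linarith)
  have hd2 : d ^ 2 = y * y + 8 * y := by rw [hd, Real.sq_sqrt (by linarith)]
  have hgb : 1.5119 ≤ √(1 + 2 * r) ∧ √(1 + 2 * r) ≤ 1.5139 :=
    sqrt_bounds (by norm_num) (by linarith) (by linarith)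
  have hcb : 1.9366 ≤ (y + d) / 2 ∧ (y + d) / 2 ≤ 1.9381 :=
    ⟨by linarith, by linarith⟩
  have hcr := mul_bounds hcb ⟨h1, h2⟩ (by norm_num) (by norm_num)
  have hkb := div_bounds (a := (y + d) / 2 * r + 2 * r - 1) (al := 1.5312) (au := 1.5433)
    ⟨by linarith, by linarith⟩ hgb (by norm_num) (by norm_num)
  refine ⟨(y + d) / 2, √(1 + 2 * r), ((y + d) / 2 * r + 2 * r - 1) / √(1 + 2 * r), hcb, hgb,
    ⟨le_trans (by norm_num) hkb.1, hkb.2.trans (by norm_num)⟩, ?_, Real.sq_sqrt (by linarith),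
    div_mul_cancel₀ _ (by linarith)⟩
  linear_combination (1 + r) ^ 2 / 4 * hd2 + (2 + (y + d) / 2) * hyR

lemma hexDensity_lt_maxDensity_of_pair {r : ℝ} (h1 : 0.643 ≤ r) (h2 : r ≤ 0.6458)
    (hP : 9 * r ^ 15 + 81 * r ^ 14 + 369 * r ^ 13 + 1161 * r ^ 12 + 2757 * r ^ 11 + 4749 * r ^ 10
      + 5805 * r ^ 9 + 5445 * r ^ 8 + 3643 * r ^ 7 + 1235 * r ^ 6 + 243 * r ^ 5 - 1029 * r ^ 4
      - 969 * r ^ 3 - 369 * r ^ 2 - 81 * r - 9 < 0) : hexDensity < maxDensity r := by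
  obtain ⟨c, g, k, hcb, hgb, hkb, hc, hg, hk⟩ := exists_pair h1 h2
  have hg0 : 0 < g := by linarith
  have harea := pair_area_lt h1 h2 hc (by linarith) hg0 hg hP
  clear hP
  have hLs : (c - r) ^ 2 + k ^ 2 = (1 + r) ^ 2 := by
    refine mul_right_cancel₀ (pow_ne_zero 2 hg0.ne') ?_
    have h3 : ((c - r) ^ 2 + k ^ 2) * g ^ 2 = (c - r) ^ 2 * g ^ 2 + (k * g) ^ 2 := by ring
    rw [h3, hk, hg]
    linear_combination hc
  have hLL : c ^ 2 + (g - k) ^ 2 = 4 := by linear_combination hLs + hg - 2 * hk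
  have hcell : c * (g + k) < 2 * √3 * (1 + r ^ 2) := by
    refine lt_of_mul_lt_mul_right ?_ hg0.le
    have : c * (g + k) * g = c * r * (4 + c) := by linear_combination c * hg + c * hk
    rwa [this]
  clear hc harea
  have hlarge : pairCell.large = ![true, true, false, false] := by
    ext i
    fin_cases i <;> rfl
  refine pairCell_stable.hexDensity_lt_maxDensity (u₁ := 2 * c) (u₂ := 0) (v₁ := c) (v₂ := g + k)
    (x := ![0, c, r, -r]) (y := ![g, k, 0, 0]) ⟨?_, ?_, ?_, ?_, ?_, ?_⟩ (by linarith) ?_ ?_ ?_ ?_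
  · norm_num [pairCell, abs_le]; constructor <;> linarith
  · norm_num [pairCell]
  · norm_num [pairCell, abs_le]; constructor <;> linarith
  · norm_num [pairCell, abs_le]; constructor <;> linarith
  · intro i
    fin_cases i <;> norm_num [pairCell, Cell.x, abs_le] <;> constructor <;> linarith
  · intro i
    fin_cases i <;> norm_num [pairCell, Cell.y, abs_le] <;> constructor <;> linarith
  · norm_num [pairCell]; linarith
  · simp only [pairContacts, List.forall_mem_cons]
    simp [Cell.ρ, hlarge]
    constructorm* _ ∧ _ <;> linarith
  · have : 0 < c * (g + k) := by nlinarith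
    linarith
  · simp [Fin.sum_univ_four, Cell.ρ, hlarge]
    linarith

/-! ### Triples of large and triples of small discs -/

/-- The contacts between three large discs `0`, `1`, `2` that touch each other and three small discs
`3`, `4`, `5`, translates of which touch each other, if each small disc touches three large ones. -/
def triangleContacts : List (Fin 6 × Fin 6 × ℤ × ℤ) :=
  [(0, 1, 0, 0), (0, 2, 0, 0), (1, 2, 0, 0), (0, 3, 1, 0), (1, 3, 0, 0), (2, 3, 0, 0),
    (0, 4, 0, 0), (1, 4, -1, 1), (2, 4, 0, 0), (3, 4, -1, 0), (0, 5, 0, 0), (1, 5, 0, 0),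
    (2, 5, 0, -1), (3, 5, 0, -1), (4, 5, 1, -1)]

/-- The cell of the packing with contacts `triangleContacts` for small radii close to `0.5507`. -/
def triangleCell : Cell 6 :=
  ⟨55020, 55120, -132294, -372625, 256556, -300882, ![(0, 115470, true), (-100000, -57735, true),
    (100000, -57735, true), (0, -176254, false), (152640, 88127, false),
    (-152640, 88127, false)]⟩

lemma triangleCell_stable : triangleCell.Stable 375 triangleContacts := by decide +kernel

/-- The norm of `U - V q`, where `U` and `V` are polynomials in `r` and `q` is a square root of
`3 r² (1 + 2 r)`. -/
lemma triangle_norm (r : ℝ) :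
    ((3 * ((1 + r) ^ 2 * (14 + 14 * r ^ 2 - 3 * (1 + r) ^ 2) - 8 * r ^ 2)) ^ 2
      + (6 * (1 + r) ^ 2) ^ 2 * (3 * r ^ 2 * (1 + 2 * r))
      - 3 * (r ^ 2 + 2 * r) * (6 * (1 + r) ^ 2) ^ 2
      - 64 * (3 * (r ^ 2 + 2 * r)) * (3 * r ^ 2 * (1 + 2 * r))) ^ 2
    - (2 * (3 * ((1 + r) ^ 2 * (14 + 14 * r ^ 2 - 3 * (1 + r) ^ 2) - 8 * r ^ 2))
        * (6 * (1 + r) ^ 2) + 16 * (6 * (1 + r) ^ 2) * (3 * (r ^ 2 + 2 * r))) ^ 2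
      * (3 * r ^ 2 * (1 + 2 * r))
    = 81 * (1 + r) ^ 4 * (14641 * r ^ 12 + 20812 * r ^ 11 - 19950 * r ^ 10 + 2204 * r ^ 9
      - 72961 * r ^ 8 - 179688 * r ^ 7 - 42116 * r ^ 6 - 179688 * r ^ 5 - 72961 * r ^ 4
      + 2204 * r ^ 3 - 19950 * r ^ 2 + 20812 * r + 14641) := by
  ring

/-- The left side lies in a biquadratic extension of `ℚ(r)`, generated by the square roots `p` and `q`,
and its norm is, up to squares, the polynomial `poly₃`. -/
lemma triangle_pos {r p q : ℝ} (h1 : 0.5502 ≤ r) (h2 : r ≤ 0.5512)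
    (hp0 : 0 < p) (hp : p ^ 2 = 3 * (r ^ 2 + 2 * r))
    (hq0 : 0 < q) (hq : q ^ 2 = 3 * r ^ 2 * (1 + 2 * r))
    (hP : 0 < 14641 * r ^ 12 + 20812 * r ^ 11 - 19950 * r ^ 10 + 2204 * r ^ 9
      - 72961 * r ^ 8 - 179688 * r ^ 7 - 42116 * r ^ 6 - 179688 * r ^ 5 - 72961 * r ^ 4
      + 2204 * r ^ 3 - 19950 * r ^ 2 + 20812 * r + 14641) :
    0 < 3 * ((1 + r) ^ 2 * (14 + 14 * r ^ 2 - 3 * (1 + r) ^ 2) - 8 * r ^ 2)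
      - 6 * (1 + r) ^ 2 * q - p * (6 * (1 + r) ^ 2 + 8 * q) := by
  have hn := mul_pos (show 0 < 81 * (1 + r) ^ 4 by nlinarith [sq_nonneg ((1 + r) ^ 2)]) hP
  rw [← triangle_norm] at hn
  clear hP
  have hr2 := mul_bounds (a := r) (b := r) ⟨h1, h2⟩ ⟨h1, h2⟩ (by norm_num) (by norm_num)
  have hr3 := mul_bounds hr2 ⟨h1, h2⟩ (by norm_num) (by norm_num)
  obtain ⟨x, hx⟩ : ∃ x, x = 6 * (1 + r) ^ 2 := ⟨_, rfl⟩
  obtain ⟨b, hb⟩ : ∃ b, b = 3 * ((1 + r) ^ 2 * (14 + 14 * r ^ 2 - 3 * (1 + r) ^ 2) - 8 * r ^ 2) :=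
    ⟨_, rfl⟩
  rw [← hx, ← hb] at hn ⊢
  rw [← hp, ← hq] at hn
  have hxb : 14.41 ≤ x ∧ x ≤ 14.44 := by
    rw [hx]; constructor <;> linarith
  have hbb : 71.5 ≤ b ∧ b ≤ 73.1 := by
    have h3 := mul_bounds (a := x / 6) (b := 14 + 14 * (r * r) - x / 2) (al := 2.4) (au := 2.41)
      (bl := 11.01) (bu := 11.05) ⟨by linarith, by linarith⟩ ⟨by linarith, by linarith⟩
      (by norm_num) (by norm_num)
    have h4 : b = 3 * (x / 6 * (14 + 14 * (r * r) - x / 2) - 8 * (r * r)) := by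
      rw [hb, hx]; ring
    constructor <;> linarith
  have hpb : p ^ 2 ≤ 4.219 := by linarith
  have hqb : q ^ 2 ≤ 1.925 := by linarith
  have hq1 : q ≤ 1.4 := by
    refine le_of_sq_le_sq ?_ (by norm_num)
    linarith
  -- `U - V * q` is the product of the expression and its conjugate, in which `p` changes its sign.
  obtain ⟨U, hU⟩ : ∃ U, U = b ^ 2 + x ^ 2 * q ^ 2 - p ^ 2 * x ^ 2 - 64 * p ^ 2 * q ^ 2 := ⟨_, rfl⟩
  obtain ⟨V, hV⟩ : ∃ V, V = 2 * b * x + 16 * x * p ^ 2 := ⟨_, rfl⟩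
  have hU0 : 0 < U := by
    have h3 : x ^ 2 ≤ 208.6 :=
      (pow_le_pow_left₀ (by linarith) hxb.2 2).trans (by norm_num)
    have h4 : p ^ 2 * x ^ 2 ≤ 4.219 * 208.6 :=
      mul_le_mul hpb h3 (by positivity) (by norm_num)
    have h5 : p ^ 2 * q ^ 2 ≤ 4.219 * 1.925 :=
      mul_le_mul hpb hqb (by positivity) (by norm_num)
    have h6 : 71.5 ^ 2 ≤ b ^ 2 := pow_le_pow_left₀ (by norm_num) hbb.1 2
    have h7 : 0 ≤ x ^ 2 * q ^ 2 := by positivity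
    rw [hU]
    norm_num at *
    linarith
  have hx0 : 0 < x := by linarith
  have hV0 : 0 < V := by
    have : 0 < b := by linarith
    rw [hV]; positivity
  have hUV : 0 < U - V * q := by
    refine pos_of_mul_pos_left (b := U + V * q) ?_ (by positivity)
    have h3 : (U - V * q) * (U + V * q) = U ^ 2 - V ^ 2 * q ^ 2 := by ring
    rw [h3, hU, hV]
    linarith
  have hxq : x * q ≤ 14.44 * 1.4 := mul_le_mul hxb.2 hq1 hq0.le (by norm_num)
  have hpos : 0 < b - x * q + p * (x + 8 * q) := by
    have : 0 < p * (x + 8 * q) := by positivity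
    norm_num at hxq
    linarith
  refine pos_of_mul_pos_left (b := b - x * q + p * (x + 8 * q)) ?_ hpos.le
  have h3 : (b - x * q - p * (x + 8 * q)) * (b - x * q + p * (x + 8 * q)) = U - V * q := by
    rw [hU, hV]; ring
  rw [h3]
  exact hUV

/-- The coordinates of the packing with contacts `triangleContacts`. The large disc `0` touches
the small disc `4` at the position `(a, b) = ((1 + s w) / 2, (w - s) / 2)` relative to its centre,
and a translate of the small disc `3` at `(-X, -Y)`. As these small discs touch, too, `(-X, -Y)` is
the image of `(a, b)` under the rotation by the apex angle of the isosceles triangle with legs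
`1 + r` and base `2 r`. The sine and the cosine of half of this angle are `σ` and `ζ`. -/
lemma exists_triangle {r : ℝ} (h1 : 0.5502 ≤ r) (h2 : r ≤ 0.5512) :
    ∃ s w z X Y : ℝ, (1.732050 ≤ s ∧ s ≤ 1.732051) ∧ (1.184533 ≤ w ∧ w ≤ 1.185843) ∧
      (2.05167 ≤ s * w ∧ s * w ≤ 2.053941) ∧
      (-1.324162 ≤ X ∧ X ≤ -1.321719) ∧ (-0.810399 ≤ Y ∧ Y ≤ -0.807624) ∧
      (-2.293517 ≤ s * X ∧ s * X ≤ -2.289283) ∧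
      (-6.457594 ≤ s * (Y - s - w) ∧ s * (Y - s - w) ≤ -6.450512) ∧
      s ^ 2 = 3 ∧ w ^ 2 = (1 + r) ^ 2 - 1 ∧ 0 < z ∧ z ^ 2 = 1 + 2 * r ∧
      X ^ 2 + Y ^ 2 = (1 + r) ^ 2 ∧
      (1 + s * w) * X + (w - s) * Y = 4 * r ^ 2 - 2 * (1 + r) ^ 2 ∧
      2 * (1 + r) ^ 2 * Y = (w - s) * (2 * r ^ 2 - (1 + r) ^ 2) - 2 * (1 + s * w) * r * z := by
  have hr2 := mul_bounds (a := r) (b := r) ⟨h1, h2⟩ ⟨h1, h2⟩ (by norm_num) (by norm_num)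
  have hR0 : 0 < 1 + r := by linarith
  obtain ⟨s, hs⟩ : ∃ s, s = √3 := ⟨_, rfl⟩
  have hsb : 1.732050 ≤ s ∧ s ≤ 1.732051 := by
    rw [hs]; exact sqrt_bounds (by norm_num) (by norm_num) (by norm_num)
  have hs2 : s ^ 2 = 3 := by rw [hs]; exact Real.sq_sqrt (by norm_num)
  obtain ⟨w, hw⟩ : ∃ w, w = √((1 + r) ^ 2 - 1) := ⟨_, rfl⟩
  have hwb : 1.184533 ≤ w ∧ w ≤ 1.185843 := by
    rw [hw]; exact sqrt_bounds (by norm_num) (by linarith) (by linarith)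
  have hw2 : w ^ 2 = (1 + r) ^ 2 - 1 := by rw [hw]; exact Real.sq_sqrt (by linarith)
  obtain ⟨σ, hσ⟩ : ∃ σ, σ = r / (1 + r) := ⟨_, rfl⟩
  have hσR : σ * (1 + r) = r := by rw [hσ, div_mul_cancel₀ _ hR0.ne']
  have hσb : 0.354921 ≤ σ ∧ σ ≤ 0.355338 := by
    rw [hσ, le_div_iff₀ hR0, div_le_iff₀ hR0]
    constructor <;> linarith
  have hσ2 := mul_bounds hσb hσb (by norm_num) (by norm_num)
  obtain ⟨ζ, hζ⟩ : ∃ ζ, ζ = √(1 - σ * σ) := ⟨_, rfl⟩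
  have hζb : 0.934737 ≤ ζ ∧ ζ ≤ 0.934897 := by
    rw [hζ]; exact sqrt_bounds (by norm_num) (by linarith) (by linarith)
  have hζ2 : ζ ^ 2 = 1 - σ * σ := by rw [hζ]; exact Real.sq_sqrt (by linarith)
  have hσζ := mul_bounds hσb hζb (by norm_num) (by norm_num)
  have hsw := mul_bounds hsb hwb (by norm_num) (by norm_num)
  obtain ⟨X, hX⟩ : ∃ X, X = (1 + s * w) / 2 * (2 * (σ * σ) - 1) + (w - s) / 2 * (2 * (σ * ζ)) :=
    ⟨_, rfl⟩
  obtain ⟨Y, hY⟩ : ∃ Y, Y = (w - s) / 2 * (2 * (σ * σ) - 1) - (1 + s * w) / 2 * (2 * (σ * ζ)) :=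
    ⟨_, rfl⟩
  have hab : 1.525835 ≤ (1 + s * w) / 2 ∧ (1 + s * w) / 2 ≤ 1.526971 :=
    ⟨by linarith, by linarith⟩
  have hbb : 0.273103 ≤ (s - w) / 2 ∧ (s - w) / 2 ≤ 0.273759 := ⟨by linarith, by linarith⟩
  have hcb : 0.747468 ≤ 1 - 2 * (σ * σ) ∧ 1 - 2 * (σ * σ) ≤ 0.748065 :=
    ⟨by linarith, by linarith⟩
  have htb : 0.663515 ≤ 2 * (σ * ζ) ∧ 2 * (σ * ζ) ≤ 0.664409 := ⟨by linarith, by linarith⟩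
  have hac := mul_bounds hab hcb (by norm_num) (by norm_num)
  have hat := mul_bounds hab htb (by norm_num) (by norm_num)
  have hbc := mul_bounds hbb hcb (by norm_num) (by norm_num)
  have hbt := mul_bounds hbb htb (by norm_num) (by norm_num)
  have hXb : 1.321719 ≤ -X ∧ -X ≤ 1.324162 := by
    have : -X = (1 + s * w) / 2 * (1 - 2 * (σ * σ)) + (s - w) / 2 * (2 * (σ * ζ)) := by
      rw [hX]; ring
    rw [this]
    constructor <;> linarith
  have hYb : 0.807624 ≤ -Y ∧ -Y ≤ 0.810399 := by
    have : -Y = (1 + s * w) / 2 * (2 * (σ * ζ)) - (s - w) / 2 * (1 - 2 * (σ * σ)) := by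
      rw [hY]; ring
    rw [this]
    constructor <;> linarith
  have hsX := mul_bounds hsb hXb (by norm_num) (by norm_num)
  have hsu := mul_bounds hsb (b := -(Y - s - w)) (bl := 3.724207) (bu := 3.728293)
    ⟨by linarith, by linarith⟩ (by norm_num) (by norm_num)
  have hR2 : (1 + r) ^ 2 = ((1 + s * w) ^ 2 + (w - s) ^ 2) / 4 := by
    linear_combination (-w ^ 2 / 4 - 1 / 4) * hs2 - hw2
  refine ⟨s, w, ζ * (1 + r), X, Y, hsb, hwb, ⟨by linarith, by linarith⟩,
    ⟨by linarith, by linarith⟩, ⟨by linarith, by linarith⟩, ⟨by linarith, by linarith⟩,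
    ⟨by linarith, by linarith⟩, hs2, hw2, mul_pos (by linarith) hR0, ?_, ?_, ?_, ?_⟩
  · linear_combination (1 + r) ^ 2 * hζ2 - (σ * (1 + r) + r) * hσR
  · rw [hX, hY]
    linear_combination ((1 + s * w) ^ 2 + (w - s) ^ 2) * σ ^ 2 * hζ2 - hR2
  · rw [hX, hY]
    linear_combination (4 * σ ^ 2 - 2) * (-1) * hR2 + 4 * (σ * (1 + r) + r) * hσR
  · rw [hY]
    linear_combination (2 * (w - s) * (σ * (1 + r) + r) - 2 * (1 + s * w) * (ζ * (1 + r))) * hσR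

/-- The lattice is hexagonal, and `(X, Y - s - w)` is a shortest vector of it. -/
lemma triangle_area_lt {r s w z X Y : ℝ} (h1 : 0.5502 ≤ r) (h2 : r ≤ 0.5512) (hs0 : 0 < s)
    (hw0 : 0 < w) (hz0 : 0 < z) (hs : s ^ 2 = 3) (hw : w ^ 2 = (1 + r) ^ 2 - 1)
    (hz : z ^ 2 = 1 + 2 * r) (hXY : X ^ 2 + Y ^ 2 = (1 + r) ^ 2)
    (hY : 2 * (1 + r) ^ 2 * Y = (w - s) * (2 * r ^ 2 - (1 + r) ^ 2) - 2 * (1 + s * w) * r * z)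
    (hP : 0 < 14641 * r ^ 12 + 20812 * r ^ 11 - 19950 * r ^ 10 + 2204 * r ^ 9
      - 72961 * r ^ 8 - 179688 * r ^ 7 - 42116 * r ^ 6 - 179688 * r ^ 5 - 72961 * r ^ 4
      + 2204 * r ^ 3 - 19950 * r ^ 2 + 20812 * r + 14641) :
    X ^ 2 + (Y - s - w) ^ 2 < 12 * (1 + r ^ 2) := by
  have hr0 : 0 < r := by linarith
  have h := triangle_pos (p := s * w) (q := s * r * z) h1 h2 (by positivity)
    (by rw [mul_pow, hs, hw]; ring) (by positivity) (by rw [mul_pow, mul_pow, hs, hz]) hP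
  clear hP
  have h3 : 3 * (1 + r) ^ 2 * (12 * (1 + r ^ 2) - (X ^ 2 + (Y - s - w) ^ 2))
      = 3 * ((1 + r) ^ 2 * (14 + 14 * r ^ 2 - 3 * (1 + r) ^ 2) - 8 * r ^ 2)
      - 6 * (1 + r) ^ 2 * (s * r * z) - s * w * (6 * (1 + r) ^ 2 + 8 * (s * r * z)) := by
    linear_combination (-3 * (1 + r) ^ 2) * hXY + 3 * (s + w) * hY
      + (3 * (2 * r ^ 2 - (1 + r) ^ 2) - 6 * r * z * s - 3 * (1 + r) ^ 2) * hw
      + (-3 * (2 * r ^ 2 - (1 + r) ^ 2) + 2 * r * z * w - 3 * (1 + r) ^ 2) * hs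
  rw [← h3] at h
  have := pos_of_mul_pos_right h (by positivity)
  linarith

lemma hexDensity_lt_maxDensity_of_triangle {r : ℝ} (h1 : 0.5502 ≤ r) (h2 : r ≤ 0.5512)
    (hP : 0 < 14641 * r ^ 12 + 20812 * r ^ 11 - 19950 * r ^ 10 + 2204 * r ^ 9
      - 72961 * r ^ 8 - 179688 * r ^ 7 - 42116 * r ^ 6 - 179688 * r ^ 5 - 72961 * r ^ 4
      + 2204 * r ^ 3 - 19950 * r ^ 2 + 20812 * r + 14641) : hexDensity < maxDensity r := by
  obtain ⟨s, w, z, X, Y, hsb, hwb, hsw, hXb, hYb, hsX, hsu, hs, hw, hz0, hz, hXY, hc, hY⟩ :=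
    exists_triangle h1 h2
  have harea := triangle_area_lt h1 h2 (by linarith) (by linarith) hz0 hs hw hz hXY hY hP
  clear hP hY
  have hs0 : 0 < s := by linarith
  have hs3 : √3 = s := by
    rw [← hs, Real.sqrt_sq (by linarith)]
  have hdet : X * (s / 2 * X + (Y - s - w) / 2) - (Y - s - w) * (X / 2 - s / 2 * (Y - s - w))
      = s / 2 * (X ^ 2 + (Y - s - w) ^ 2) := by ring
  have hcell : X * (s / 2 * X + (Y - s - w) / 2) - (Y - s - w) * (X / 2 - s / 2 * (Y - s - w))
      < 2 * √3 * (3 + 3 * r ^ 2) := by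
    rw [hs3, hdet]
    have := mul_lt_mul_of_pos_left harea (half_pos hs0)
    linarith
  have hcell0 : 0 < X * (s / 2 * X + (Y - s - w) / 2)
      - (Y - s - w) * (X / 2 - s / 2 * (Y - s - w)) := by
    rw [hdet]
    have : X ≠ 0 := by
      have : X < 0 := by linarith
      exact this.ne
    positivity
  clear harea hdet
  have hlarge : triangleCell.large = ![true, true, true, false, false, false] := by
    ext i
    fin_cases i <;> rfl
  refine triangleCell_stable.hexDensity_lt_maxDensity (u₁ := X) (u₂ := Y - s - w)
    (v₁ := X / 2 - s / 2 * (Y - s - w)) (v₂ := s / 2 * X + (Y - s - w) / 2)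
    (x := ![0, -1, 1, 0, 1 / 2 + s * w / 2, -(1 / 2 + s * w / 2)])
    (y := ![2 * s / 3, -s / 3, -s / 3, -(s / 3 + w), s / 6 + w / 2, s / 6 + w / 2])
    ⟨?_, ?_, ?_, ?_, ?_, ?_⟩ (by linarith) ?_ ?_ ?_ ?_
  · norm_num [triangleCell, abs_le]; constructor <;> linarith
  · norm_num [triangleCell, abs_le]; constructor <;> linarith
  · norm_num [triangleCell, abs_le]; constructor <;> linarith
  · norm_num [triangleCell, abs_le]; constructor <;> linarith
  · intro i
    fin_cases i <;> norm_num [triangleCell, Cell.x, abs_le] <;> constructor <;> linarith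
  · intro i
    fin_cases i <;> norm_num [triangleCell, Cell.y, abs_le] <;> constructor <;> linarith
  · norm_num [triangleCell]; linarith
  -- The distances agree with the sums of the radii modulo `s ^ 2 = 3`.
  · have hsm (t : ℝ) : s ^ 2 * t = 3 * t := by rw [hs]
    simp only [triangleContacts, List.forall_mem_cons]
    simp [Cell.ρ, hlarge]
    constructorm* _ ∧ _ <;>
      linarith only [hs, hw, hXY, hc, hsm s, hsm (s ^ 2), hsm (w ^ 2), hsm (s * w), hsm (s * Y),
        hsm (w * Y), hsm (X ^ 2), hsm (Y ^ 2), hsm X, hsm w, hsm Y, hsm (w * X), hsm (s * X)]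
  · linarith
  · simp [Fin.sum_univ_six, Cell.ρ, hlarge]
    linarith

/-! ### The roots of the five polynomials -/

/-- A polynomial whose derivative is positive on `[l, u]`, and that changes its sign between
`c - 0.0002` and `c + 0.0002`, has a single root `a` there, and its sign on `[l, u]` is known. -/
lemma exists_isOnlyRootNear {P : ℤ[X]} {c l u : ℝ}
    (hP : ∀ x : ℝ, l ≤ x → x ≤ u → 0 < aeval x (derivative P))
    (hl : l ≤ c - 0.0002) (hu : c + 0.0002 ≤ u) (h1 : aeval (c - 0.0002) P < 0)
    (h2 : 0 < aeval (c + 0.0002) P) :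
    ∃ a, IsOnlyRootNear P c a ∧ c - 0.0002 < a ∧ a < c + 0.0002 ∧
      (∀ x, l ≤ x → x < a → aeval x P < 0) ∧ (∀ x, x ≤ u → a < x → 0 < aeval x P) := by
  have hmono : StrictMonoOn (fun x : ℝ => aeval x P) (Set.Icc l u) := by
    refine strictMonoOn_of_deriv_pos (convex_Icc l u) P.continuous_aeval.continuousOn fun x hx => ?_
    rw [interior_Icc] at hx
    rw [Polynomial.deriv_aeval]
    exact hP x hx.1.le hx.2.le
  obtain ⟨a, ⟨ha1, ha2⟩, ha⟩ := intermediate_value_Ioo (show c - 0.0002 ≤ c + 0.0002 by linarith)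
    (P.continuous_aeval (A := ℝ)).continuousOn ⟨h1, h2⟩
  have ha0 : aeval a P = 0 := ha
  have haI : a ∈ Set.Icc l u := ⟨by linarith, by linarith⟩
  refine ⟨a, ?_, ha1, ha2, fun x hx hxa => ?_, fun x hx hxa => ?_⟩
  · ext x
    simp only [Set.mem_ofPred_eq, Set.mem_singleton_iff]
    constructor
    · rintro ⟨hx, hx0⟩
      have hx := abs_lt.1 hx
      exact hmono.injOn ⟨by linarith, by linarith⟩ haI (hx0.trans ha0.symm)
    · rintro rfl
      exact ⟨abs_lt.2 ⟨by linarith, by linarith⟩, ha0⟩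
  · rw [← ha0]
    exact hmono ⟨hx, by linarith⟩ haI hxa
  · rw [← ha0]
    exact hmono haI ⟨by linarith, hx⟩ hxa

lemma IsOnlyRootNear.of_neg {P : ℤ[X]} {c a : ℝ} (h : IsOnlyRootNear (-P) c a) :
    IsOnlyRootNear P c a := by
  simpa [IsOnlyRootNear] using h

lemma pow_bounds {l u x : ℝ} (hl0 : 0 ≤ l) (hl : l ≤ x) (hu : x ≤ u) (k : ℕ) :
    l ^ k ≤ x ^ k ∧ x ^ k ≤ u ^ k :=
  ⟨pow_le_pow_left₀ hl0 hl k, pow_le_pow_left₀ (hl0.trans hl) hu k⟩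

lemma aeval_poly₁₄ (x : ℝ) : aeval x poly₁₄ =
    3 * x ^ 12 + 24 * x ^ 11 + 90 * x ^ 10 + 216 * x ^ 9 + 381 * x ^ 8 + 528 * x ^ 7
      + 524 * x ^ 6 + 144 * x ^ 5 - 387 * x ^ 4 - 296 * x ^ 3 + 90 * x ^ 2 + 24 * x + 3 := by
  simp only [poly₁₄, map_add, map_sub, map_mul, map_pow, aeval_X, map_ofNat]

lemma aeval_poly₂ (x : ℝ) : aeval x poly₂ =
    144 * x ^ 12 + 576 * x ^ 11 + 1152 * x ^ 10 + 1728 * x ^ 9 + 1704 * x ^ 8 + 672 * x ^ 7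
      + 312 * x ^ 6 - 384 * x ^ 5 - 143 * x ^ 4 + 52 * x ^ 3 - 50 * x ^ 2 - 12 * x + 9 := by
  simp only [poly₂, map_add, map_sub, map_mul, map_pow, aeval_X, map_ofNat]

lemma aeval_poly₃ (x : ℝ) : aeval x poly₃ =
    14641 * x ^ 12 + 20812 * x ^ 11 - 19950 * x ^ 10 + 2204 * x ^ 9 - 72961 * x ^ 8
      - 179688 * x ^ 7 - 42116 * x ^ 6 - 179688 * x ^ 5 - 72961 * x ^ 4 + 2204 * x ^ 3
      - 19950 * x ^ 2 + 20812 * x + 14641 := by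
  simp only [poly₃, map_add, map_sub, map_mul, map_pow, aeval_X, map_ofNat]

lemma aeval_poly₅ (x : ℝ) : aeval x poly₅ =
    9 * x ^ 15 + 81 * x ^ 14 + 369 * x ^ 13 + 1161 * x ^ 12 + 2757 * x ^ 11 + 4749 * x ^ 10
      + 5805 * x ^ 9 + 5445 * x ^ 8 + 3643 * x ^ 7 + 1235 * x ^ 6 + 243 * x ^ 5 - 1029 * x ^ 4
      - 969 * x ^ 3 - 369 * x ^ 2 - 81 * x - 9 := by
  simp only [poly₅, map_add, map_sub, map_mul, map_pow, aeval_X, map_ofNat]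

lemma exists_root₁ : ∃ a, IsOnlyRootNear poly₁₄ 0.4378 a ∧ 0.4376 < a ∧ a < 0.438 ∧
    ∀ x, 0.432 ≤ x → x < a → 0 < aeval x poly₁₄ := by
  have hd (x : ℝ) (hl : 0.432 ≤ x) (hu : x ≤ 0.438) : 0 < aeval x (derivative (-poly₁₄)) := by
    have h := pow_bounds (by norm_num) hl hu
    simp [poly₁₄]
    simp only [map_ofNat]
    linarith [h 2, h 3, h 4, h 5, h 6, h 7, h 8, h 9, h 10, h 11]
  obtain ⟨a, ha, h1, h2, h, -⟩ := exists_isOnlyRootNear (c := 0.4378) hd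
    (by norm_num) (by norm_num)
    (by rw [map_neg, aeval_poly₁₄]; norm_num) (by rw [map_neg, aeval_poly₁₄]; norm_num)
  exact ⟨a, ha.of_neg, by linarith, by linarith, fun x hx hxa => by simpa using h x hx hxa⟩

lemma exists_root₂ : ∃ a, IsOnlyRootNear poly₂ 0.5165 a ∧ 0.5163 < a ∧ a < 0.5167 ∧
    ∀ x, x ≤ 0.519 → a < x → 0 < aeval x poly₂ := by
  have hd (x : ℝ) (hl : 0.5163 ≤ x) (hu : x ≤ 0.519) : 0 < aeval x (derivative poly₂) := by
    have h := pow_bounds (by norm_num) hl hu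
    simp [poly₂]
    simp only [map_ofNat]
    linarith [h 2, h 3, h 4, h 5, h 6, h 7, h 8, h 9, h 10, h 11]
  obtain ⟨a, ha, h1, h2, -, h⟩ := exists_isOnlyRootNear (c := 0.5165) hd
    (by norm_num) (by norm_num)
    (by rw [aeval_poly₂]; norm_num) (by rw [aeval_poly₂]; norm_num)
  exact ⟨a, ha, by linarith, by linarith, h⟩

lemma exists_root₃ : ∃ a, IsOnlyRootNear poly₃ 0.5510 a ∧ 0.5508 < a ∧ a < 0.5512 ∧
    ∀ x, 0.5502 ≤ x → x < a → 0 < aeval x poly₃ := by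
  have hd (x : ℝ) (hl : 0.5502 ≤ x) (hu : x ≤ 0.5512) : 0 < aeval x (derivative (-poly₃)) := by
    have h := pow_bounds (by norm_num) hl hu
    simp [poly₃]
    simp only [map_ofNat]
    linarith [h 2, h 3, h 4, h 5, h 6, h 7, h 8, h 9, h 10, h 11]
  obtain ⟨a, ha, h1, h2, h, -⟩ := exists_isOnlyRootNear (c := 0.5510) hd
    (by norm_num) (by norm_num)
    (by rw [map_neg, aeval_poly₃]; norm_num) (by rw [map_neg, aeval_poly₃]; norm_num)
  exact ⟨a, ha.of_neg, by linarith, by linarith, fun x hx hxa => by simpa using h x hx hxa⟩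

lemma exists_root₄ : ∃ a, IsOnlyRootNear poly₁₄ 0.6276 a ∧ 0.6274 < a ∧ a < 0.6278 ∧
    ∀ x, x ≤ 0.63 → a < x → 0 < aeval x poly₁₄ := by
  have hd (x : ℝ) (hl : 0.6274 ≤ x) (hu : x ≤ 0.63) : 0 < aeval x (derivative poly₁₄) := by
    have h := pow_bounds (by norm_num) hl hu
    simp [poly₁₄]
    simp only [map_ofNat]
    linarith [h 2, h 3, h 4, h 5, h 6, h 7, h 8, h 9, h 10, h 11]
  obtain ⟨a, ha, h1, h2, -, h⟩ := exists_isOnlyRootNear (c := 0.6276) hd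
    (by norm_num) (by norm_num)
    (by rw [aeval_poly₁₄]; norm_num) (by rw [aeval_poly₁₄]; norm_num)
  exact ⟨a, ha, by linarith, by linarith, h⟩

lemma exists_root₅ : ∃ a, IsOnlyRootNear poly₅ 0.6456 a ∧ 0.6454 < a ∧ a < 0.6458 ∧
    ∀ x, 0.643 ≤ x → x < a → aeval x poly₅ < 0 := by
  have hd (x : ℝ) (hl : 0.643 ≤ x) (hu : x ≤ 0.6458) : 0 < aeval x (derivative poly₅) := by
    have h := pow_bounds (by norm_num) hl hu
    simp [poly₅]
    simp only [map_ofNat]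
    linarith [h 2, h 3, h 4, h 5, h 6, h 7, h 8, h 9, h 10, h 11, h 12, h 13, h 14]
  obtain ⟨a, ha, h1, h2, h, -⟩ := exists_isOnlyRootNear (c := 0.6456) hd
    (by norm_num) (by norm_num)
    (by rw [aeval_poly₅]; norm_num) (by rw [aeval_poly₅]; norm_num)
  exact ⟨a, ha, by linarith, by linarith, h⟩

end BinaryDisc

end

theorem corollary1 :
    ∃ a₁ a₂ a₃ a₄ a₅ : ℝ,
      BinaryDisc.IsOnlyRootNear BinaryDisc.poly₁₄ 0.4378 a₁ ∧
      BinaryDisc.IsOnlyRootNear BinaryDisc.poly₂ 0.5165 a₂ ∧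
      BinaryDisc.IsOnlyRootNear BinaryDisc.poly₃ 0.5510 a₃ ∧
      BinaryDisc.IsOnlyRootNear BinaryDisc.poly₁₄ 0.6276 a₄ ∧
      BinaryDisc.IsOnlyRootNear BinaryDisc.poly₅ 0.6456 a₅ ∧
      ∀ r ∈ Set.Ioo 0 a₁ ∪ Set.Ioo a₂ a₃ ∪ Set.Ioo a₄ a₅,
        BinaryDisc.hexDensity < BinaryDisc.maxDensity r := by
  open BinaryDisc in
  obtain ⟨a₁, h₁, hl₁, hu₁, hs₁⟩ := exists_root₁
  obtain ⟨a₂, h₂, hl₂, hu₂, hs₂⟩ := exists_root₂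
  obtain ⟨a₃, h₃, hl₃, hu₃, hs₃⟩ := exists_root₃
  obtain ⟨a₄, h₄, hl₄, hu₄, hs₄⟩ := exists_root₄
  obtain ⟨a₅, h₅, hl₅, hu₅, hs₅⟩ := exists_root₅
  refine ⟨a₁, a₂, a₃, a₄, a₅, h₁, h₂, h₃, h₄, h₅, ?_⟩
  rintro r ((⟨hl, hu⟩ | ⟨hl, hu⟩) | ⟨hl, hu⟩)
  · rcases le_or_gt r 0.154 with h | h
    · exact hexDensity_lt_maxDensity_of_le hl h
    rcases lt_or_ge r 0.4325 with h' | h'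
    · exact hexDensity_lt_maxDensity_of_mem_cellsA (by linarith) h'
    have hP := hs₁ r (by linarith) hu
    rw [aeval_poly₁₄] at hP
    exact hexDensity_lt_maxDensity_of_trapezoid₁ (by linarith) (by linarith) (by linarith)
  · rcases le_or_gt r 0.519 with h | h
    · have hP := hs₂ r h hl
      rw [aeval_poly₂] at hP
      exact hexDensity_lt_maxDensity_of_row (by linarith) h hP
    rcases lt_or_ge r 0.5503 with h' | h'
    · exact hexDensity_lt_maxDensity_of_mem_cellsB h.le h'
    have hP := hs₃ r (by linarith) hu
    rw [aeval_poly₃] at hP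
    exact hexDensity_lt_maxDensity_of_triangle (by linarith) (by linarith) hP
  · rcases le_or_gt r 0.63 with h | h
    · have hP := hs₄ r h hl
      rw [aeval_poly₁₄] at hP
      exact hexDensity_lt_maxDensity_of_trapezoid₂ (by linarith) h (by linarith)
    rcases lt_or_ge r 0.6435 with h' | h'
    · exact hexDensity_lt_maxDensity_of_mem_cellsC (by linarith) h'
    have hP := hs₅ r (by linarith) hu
    rw [aeval_poly₅] at hP
    exact hexDensity_lt_maxDensity_of_pair (by linarith) (by linarith) hP
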